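/- **Setting.** Consider a constrained Markov decision process with state space $S$, finite nonempty action set $A$, transition model $P$, initial distribution $\rho$, discount factor $\gamma\in(0,1)$, bounded reward $R(s,a,s')$ and bounded nonnegative costs $C_1,\dots,C_N$ (functions of $(s,a,s')$). Let $D\subseteq S$ be a (possibly empty) set of states that is never left and in which all costs vanish (e.g. terminal states). Augmented states are $\bar s=(s,(e_i)_{i\le N},b)$; the process starts at $(s_0,0,1)$ with $s_0\sim\rho$, and after action $a$ and next state $s'\sim P(\cdot|s,a)$ it moves to $(s',((C_i(s,a,s')+e_i)/\gamma)_i,\gamma b)$ if $s\notin D$, and to $(s',(e_i)_i,b)$ if $s\in D$. Let $\bar S$ be the set of augmented states that can be reached with positive probability under some choice of actions, and assume that $\bar S$ is finite. A policy is a map $\pi$ from $\bar S$ to probability distributions on $A$. Write $G_R^\pi=\sum_{t\ge0}\gamma^tR(s_t,a_t,s_{t+1})$ and $G_{C_i}^\pi=\sum_{t\ge0}\gamma^tC_i(s_t,a_t,s_{t+1})$ for the returns under $\pi$, and $d_\rho^\pi(\bar s)=(1-\gamma)\sum_{t\ge0}\gamma^t\,\mathbb P_\pi(\bar s_t=\bar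 s)$. For each $i$ let $\sigma_i\ge0$ be an increasing function on $(0,1)$ with $\int_0^1\sigma_i=1$, and let $g_i:\mathbb R\to\mathbb R$ be an increasing convex function, with conjugate $g_i^*(y)=\sup_x(xy-g_i(x))$, such that $g_i^*(\sigma_i(u))$ is finite for $u\in(0,1)$ and integrable in $u$. Put $$J_R(\pi)=\mathbb E[G_R^\pi],\qquad J_{C_i}(\pi)=\mathbb E[g_i(G_{C_i}^\pi)]+\int_0^1g_i^*(\sigma_i(u))\,du .$$ Given thresholds $d_1,\dots,d_N\in\mathbb R$, the inner problem is to maximize $J_R(\pi)$ over all policies $\pi$ subject to $J_{C_i}(\pi)\le d_i$ for all $i$. **Update rule.** For $\theta\in\mathbb R^{\bar S\times A}$ let $\pi_\theta(a|\bar s)=e^{\theta(\bar s,a)}/\sum_{a'}e^{\theta(\bar s,a')}$, let $J_R(\theta)=J_R(\pi_\theta)$ and $J_{C_i}(\theta)=J_{C_i}(\pi_\theta)$, and let $F(\theta)=\mathbb E_{\bar s\sim d_\rho^{\pi_\theta},\,a\sim\pi_\theta(\cdot|\bar s)}[\nabla_\theta\log\pi_\theta(a|\bar s)\,\nabla_\theta\log\pi_\theta(a|\bar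 s)^{\mathsf T}]$, with Moore–Penrose inverse $F^\dagger(\theta)$. Let $\theta_0$ be arbitrary and $$\theta_{t+1}=\begin{cases}\theta_t+\alpha_tF^\dagger(\theta_t)\nabla_\theta\bigl(J_R(\theta)-\alpha_t\sum_i\lambda_{t,i}J_{C_i}(\theta)\bigr)\big|_{\theta=\theta_t}&\text{if }J_{C_i}(\theta_t)\le d_i\ \forall i,\\[2pt]\theta_t+\alpha_tF^\dagger(\theta_t)\nabla_\theta\bigl(\alpha_t\nu_tJ_R(\theta)-\sum_i\lambda_{t,i}J_{C_i}(\theta)\bigr)\big|_{\theta=\theta_t}&\text{otherwise,}\end{cases}$$ where $\lambda_{t,i},\nu_t\in[0,\lambda_{\max}]$ are arbitrary weights such that, whenever some constraint is violated at $\theta_t$, $\sum_i\lambda_{t,i}=1$ and $\lambda_{t,i}=0$ for every $i$ with $J_{C_i}(\theta_t)\le d_i$; and where $\alpha_t>0$, $\sum_t\alpha_t=\infty$, $\sum_t\alpha_t^2<\infty$. **Theorem.** Assume that there are $\eta>0$ and a policy $\pi_f$ with $J_{C_i}(\pi_f)\le d_i-\eta$ for all $i$. Then the policies $\pi_{\theta_t}$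 converge to an optimal policy of the inner problem, in the following sense. There is an optimal policy $\pi^*$ of the inner problem such that, as $t\to\infty$, $\pi_{\theta_t}(a|\bar s)\to\pi^*(a|\bar s)$ for every $a\in A$ and every $\bar s$ with $d_\rho^{\pi^*}(\bar s)>0$; moreover $J_R(\pi_{\theta_t})\to J_R(\pi^*)$ and $J_{C_i}(\pi_{\theta_t})\to J_{C_i}(\pi^*)$ for all $i$. Furthermore, for every $\varepsilon>0$ and all sufficiently large $t$ there is an optimal policy $\pi$ of the inner problem with $|\pi_{\theta_t}(a|\bar s)-\pi(a|\bar s)|<\varepsilon$ for all $(\bar s,a)\in\bar S\times A$. -/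

import Mathlib

open MeasureTheory ProbabilityTheory Filter Topology

namespace RiskRL

noncomputable section

/-! ### Spectral risk measures and sub-risk measures -/

/-- `σ` is a spectrum: nonnegative and increasing on `(0, 1)`, with integral one. -/
structure IsSpectrum (σ : ℝ → ℝ) : Prop where
  nonneg : ∀ u ∈ Set.Ioo (0 : ℝ) 1, 0 ≤ σ u
  mono : MonotoneOn σ (Set.Ioo 0 1)
  integral_eq_one : ∫ u in (0 : ℝ)..1, σ u = 1

/-- The convex conjugate `g*(y) = sup_x (x y - g x)` (a real number whenever that supremum
is finite). -/
def conj (g : ℝ → ℝ) (y : ℝ) : ℝ := ⨆ x : ℝ, (x * y - g x)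

/-- `g` is an increasing convex function for which the constant `∫₀¹ g*(σ(u)) du` of the sub-risk
measure is a (finite) real number. -/
structure IsDualFunction (σ g : ℝ → ℝ) : Prop where
  mono : Monotone g
  convex : ConvexOn ℝ Set.univ g
  conj_finite : ∀ u ∈ Set.Ioo (0 : ℝ) 1, BddAbove (Set.range fun x : ℝ => x * σ u - g x)
  conj_integrable : IntervalIntegrable (fun u => conj g (σ u)) volume 0 1

/-- The sub-risk measure `R_σ^g(X) = E[g(X)] + ∫₀¹ g*(σ(u)) du` of a random variable `X` on the
probability space `(Ω, μ)`. -/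
def subRisk {Ω : Type*} [MeasurableSpace Ω] (σ g : ℝ → ℝ) (μ : Measure Ω) (X : Ω → ℝ) : ℝ :=
  ∫ ω, g (X ω) ∂μ + ∫ u in (0 : ℝ)..1, conj g (σ u)

/-! ### The constrained Markov decision process and its augmented states -/

/-- A constrained Markov decision process with `N` nonnegative costs. `costFree` is a (possibly
empty) set of states that is never left and in which no cost is incurred, for instance a set of
terminal states. -/
structure CMDP (S A : Type*) (N : ℕ) where
  P : S → A → PMF S
  ρ : PMF S
  γ : ℝ
  γ_pos : 0 < γ
  γ_lt_one : γ < 1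
  R : S → A → S → ℝ
  R_bounded : ∃ Rmax : ℝ, ∀ s a s', |R s a s'| ≤ Rmax
  C : Fin N → S → A → S → ℝ
  C_nonneg : ∀ i s a s', 0 ≤ C i s a s'
  C_bounded : ∃ Cmax : ℝ, ∀ i s a s', C i s a s' ≤ Cmax
  costFree : Set S
  costFree_closed : ∀ s ∈ costFree, ∀ a, ∀ s' ∈ (P s a).support, s' ∈ costFree
  costFree_cost : ∀ i, ∀ s ∈ costFree, ∀ a s', C i s a s' = 0

/-- Augmented states `(s, (e_i)_i, b)`. -/
@[ext] structure AugState (S : Type*) (N : ℕ) where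
  s : S
  e : Fin N → ℝ
  b : ℝ

namespace CMDP

variable {S A : Type*} {N : ℕ} (M : CMDP S A N)

open Classical in
/-- Successor augmented state: `e_i` becomes `(C_i(s, a, s') + e_i) / γ` and `b` becomes `γ b`.
The coordinates `e` and `b` stay as they are once the cost-free set is reached. -/
def next (x : AugState S N) (a : A) (s' : S) : AugState S N :=
  if x.s ∈ M.costFree then ⟨s', x.e, x.b⟩
  else ⟨s', fun i => (M.C i x.s a s' + x.e i) / M.γ, M.γ * x.b⟩

/-- The augmented states that occur with positive probability under some choice of actions,
starting from `(s₀, 0, 1)` with `s₀ ∼ ρ`. -/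
inductive Reachable : AugState S N → Prop
  | init (s : S) (hs : s ∈ M.ρ.support) : Reachable ⟨s, fun _ => 0, 1⟩
  | step (x : AugState S N) (a : A) (s' : S) (hx : Reachable x)
      (hs' : s' ∈ (M.P x.s a).support) : Reachable (M.next x a s')

/-- The augmented state space. -/
abbrev AugSpace : Type _ := {x : AugState S N // M.Reachable x}

/-- Initial distribution on the augmented state space. -/
def augInit : PMF M.AugSpace :=
  M.ρ.bindOnSupport fun s hs => PMF.pure ⟨⟨s, fun _ => 0, 1⟩, Reachable.init s hs⟩

/-- Transition model on the augmented state space. -/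
def augStep (x : M.AugSpace) (a : A) : PMF M.AugSpace :=
  (M.P x.1.s a).bindOnSupport fun s' hs' =>
    PMF.pure ⟨M.next x.1 a s', Reachable.step x.1 a s' x.2 hs'⟩

/-- Policies on the augmented state space. -/
abbrev Policy : Type _ := M.AugSpace → PMF A

/-- Pairs of an augmented state and an action, with the discrete σ-algebra. -/
def StateAction : Type _ := M.AugSpace × A

instance : MeasurableSpace M.StateAction := ⊤

/-- Draw `a ∼ π(·|x)` for `x ∼ p`. -/
def withAction (π : M.Policy) (p : PMF M.AugSpace) : PMF M.StateAction :=
  p.bind fun x => (π x).map fun a => (x, a)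

/-- One step `(x, a) ↦ (x', a')` with `x' ∼ P(·|x, a)` and `a' ∼ π(·|x')`. -/
def stepKernel (π : M.Policy) : Kernel M.StateAction M.StateAction where
  toFun z := (M.withAction π (M.augStep z.1 z.2)).toMeasure
  measurable' := measurable_from_top

instance (π : M.Policy) : IsMarkovKernel (M.stepKernel π) :=
  ⟨fun _ => PMF.toMeasure.isProbabilityMeasure _⟩

/-- The step kernel as a function of the history up to time `n`. -/
def historyKernel (π : M.Policy) (n : ℕ) :
    Kernel (Π _ : Finset.Iic n, M.StateAction) M.StateAction :=
  (M.stepKernel π).comap (fun h => h ⟨n, Finset.mem_Iic.2 le_rfl⟩) (measurable_pi_apply _)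

instance (π : M.Policy) (n : ℕ) : IsMarkovKernel (M.historyKernel π n) := by
  unfold historyKernel; infer_instance

/-- Law of the trajectory `(x_t, a_t)_t` under the policy `π`. -/
def law (π : M.Policy) : Measure (ℕ → M.StateAction) :=
  Kernel.trajMeasure (X := fun _ => M.StateAction)
    (M.withAction π M.augInit).toMeasure (M.historyKernel π)

/-- Return `∑_t γ^t r(s_t, a_t, s_{t+1})` of a trajectory. -/
def discReturn (r : S → A → S → ℝ) (ω : ℕ → M.StateAction) : ℝ :=
  ∑' t : ℕ, M.γ ^ t * r (ω t).1.1.s (ω t).2 (ω (t + 1)).1.1.s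

/-- Objective `J_R(π) = E[G_R^π]`. -/
def JR (π : M.Policy) : ℝ := ∫ ω, M.discReturn M.R ω ∂(M.law π)

/-- Constraint functions `J_{C_i}(π) = R_{σ_i}^{g_i}(G_{C_i}^π)`. -/
def JC (σ g : Fin N → ℝ → ℝ) (i : Fin N) (π : M.Policy) : ℝ :=
  subRisk (σ i) (g i) (M.law π) (M.discReturn (M.C i))

/-- Discounted state distribution `d_ρ^π(x) = (1 - γ) ∑_t γ^t ℙ(x_t = x)`. -/
def occupancy (π : M.Policy) (x : M.AugSpace) : ℝ :=
  (1 - M.γ) * ∑' t : ℕ, M.γ ^ t * (M.law π).real {ω | (ω t).1 = x}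

/-- `π` satisfies all constraints. -/
def IsFeasible (σ g : Fin N → ℝ → ℝ) (d : Fin N → ℝ) (π : M.Policy) : Prop :=
  ∀ i, M.JC σ g i π ≤ d i

/-- `π` is an optimal policy of the inner problem: maximize `J_R` subject to the constraints. -/
def IsOptimal (σ g : Fin N → ℝ → ℝ) (d : Fin N → ℝ) (π : M.Policy) : Prop :=
  M.IsFeasible σ g d π ∧ ∀ π' : M.Policy, M.IsFeasible σ g d π' → M.JR π' ≤ M.JR π

end CMDP

/-! ### Moore–Penrose inverse -/

/-- The four Penrose equations for a real matrix. -/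
structure IsMoorePenrose {n : Type*} [Fintype n] (F X : Matrix n n ℝ) : Prop where
  mul_mul_self : F * X * F = F
  self_mul_mul : X * F * X = X
  left_symm : (F * X).transpose = F * X
  right_symm : (X * F).transpose = X * F

/-- Symmetric matrices, such as Fisher information matrices, have a Moore–Penrose inverse. -/
theorem exists_isMoorePenrose {n : Type*} [Fintype n] [DecidableEq n] (F : Matrix n n ℝ) (hF : F.IsHermitian) :
    ∃ X, IsMoorePenrose F X := by
  have h := hF.spectral_theorem
  set U : Matrix n n ℝ := (hF.eigenvectorUnitary : Matrix n n ℝ) with hU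
  have h1 : star U * U = 1 := Matrix.UnitaryGroup.star_mul_self _
  set v : n → ℝ := hF.eigenvalues with hv
  have h' : F = U * Matrix.diagonal v * star U := by
    simpa [Unitary.conjStarAlgAut_apply, Function.comp_def] using h
  have key : ∀ a b : n → ℝ, (U * Matrix.diagonal a * star U) * (U * Matrix.diagonal b * star U)
      = U * Matrix.diagonal (a * b) * star U := by
    intro a b
    calc _ = U * Matrix.diagonal a * (star U * U) * Matrix.diagonal b * star U := by
            simp only [Matrix.mul_assoc]
      _ = _ := by rw [h1, Matrix.mul_one, Matrix.mul_assoc U, Matrix.diagonal_mul_diagonal]; rfl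
  have hs : ∀ a : n → ℝ, (U * Matrix.diagonal a * star U).transpose = U * Matrix.diagonal a * star U := by
    intro a
    have : star U = U.transpose := by rw [Matrix.star_eq_conjTranspose, Matrix.conjTranspose_eq_transpose_of_trivial]
    rw [this]; simp [Matrix.transpose_mul, Matrix.mul_assoc]
  refine ⟨U * Matrix.diagonal v⁻¹ * star U, ?_, ?_, ?_, ?_⟩ <;> rw [h']
  · rw [key, key]; congr 3; ext i; simp
  · rw [key, key]; congr 3; ext i; by_cases h0 : v i = 0 <;> simp [h0]
  · rw [key, hs]
  · rw [key, hs]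

open Classical in
/-- The Moore–Penrose inverse `F†`. -/
def pinv {n : Type*} [Fintype n] (F : Matrix n n ℝ) : Matrix n n ℝ :=
  if h : ∃ X, IsMoorePenrose F X then h.choose else 0

/-! ### Softmax policies and the natural policy gradient update -/

namespace CMDP

variable {S A : Type*} {N : ℕ} (M : CMDP S A N) [Fintype A] [Nonempty A]

/-- Policy parameters `θ : S̄ × A → ℝ`. -/
abbrev Param : Type _ := EuclideanSpace ℝ (M.AugSpace × A)

/-- The softmax policy `π_θ(a|x) = exp θ(x,a) / ∑_{a'} exp θ(x,a')`. -/
def softmax (θ : M.Param) : M.Policy := fun x =>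
  PMF.ofFintype
    (fun a => ENNReal.ofReal (Real.exp (θ (x, a)) / ∑ a' : A, Real.exp (θ (x, a')))) (by
      have h : 0 < ∑ a' : A, Real.exp (θ (x, a')) :=
        Finset.sum_pos (fun _ _ => Real.exp_pos _) Finset.univ_nonempty
      rw [← ENNReal.ofReal_sum_of_nonneg (fun a _ => by positivity), ← Finset.sum_div,
        div_self h.ne', ENNReal.ofReal_one])

variable [Fintype M.AugSpace]

/-- The score function `∇_θ log π_θ(a|x)`. -/
def score (θ : M.Param) (x : M.AugSpace) (a : A) : M.Param :=
  gradient (fun θ' : M.Param => Real.log (M.softmax θ' x a).toReal) θ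

/-- Fisher information matrix
`F(θ) = E_{x ∼ d_ρ^{π_θ}, a ∼ π_θ(·|x)} [∇_θ log π_θ(a|x) (∇_θ log π_θ(a|x))ᵀ]`. -/
def fisher (θ : M.Param) : Matrix (M.AugSpace × A) (M.AugSpace × A) ℝ :=
  Matrix.of fun p q => ∑ x : M.AugSpace, ∑ a : A,
    M.occupancy (M.softmax θ) x * (M.softmax θ x a).toReal *
      (M.score θ x a p * M.score θ x a q)

open Classical in
/-- One step of the update rule at parameter `θ` with learning rate `α`, constraint weights `lam`
and objective weight `ν`. -/
def update (σ g : Fin N → ℝ → ℝ) (d : Fin N → ℝ) (α : ℝ) (lam : Fin N → ℝ) (ν : ℝ)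
    (θ : M.Param) : M.Param :=
  θ + α • Matrix.toEuclideanLin (pinv (M.fisher θ))
    (if M.IsFeasible σ g d (M.softmax θ) then
      gradient (fun θ' : M.Param =>
        M.JR (M.softmax θ') - α * ∑ i, lam i * M.JC σ g i (M.softmax θ')) θ
    else
      gradient (fun θ' : M.Param =>
        α * ν * M.JR (M.softmax θ') - ∑ i, lam i * M.JC σ g i (M.softmax θ')) θ)

end CMDP

/-- Robbins–Monro step sizes. -/
structure RobbinsMonro (α : ℕ → ℝ) : Prop where
  pos : ∀ t, 0 < α t
  sum_eq_top : Tendsto (fun n => ∑ t ∈ Finset.range n, α t) atTop atTop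
  sq_summable : Summable fun t => α t ^ 2

end

end RiskRL

namespace RiskRL
noncomputable section
namespace CMDP

set_option linter.unusedSectionVars false

variable {S A : Type*} {N : ℕ} (M : CMDP S A N)

theorem withAction_apply (π : M.Policy) (p : PMF M.AugSpace) (x : M.AugSpace) (a : A) :
    M.withAction π p (x, a) = p x * π x a := by
  classical
  change (p.bind fun x => (PMF.map (Prod.mk x) (π x) : PMF (M.AugSpace × A))) (x, a) = _
  rw [PMF.bind_apply, tsum_eq_single x]
  · congr 1
    rw [PMF.map_apply, tsum_eq_single a]
    · simp
    · intro b hb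
      rw [if_neg]
      intro h
      exact hb (Prod.ext_iff.1 h).2.symm
  · intro y hy
    rw [PMF.map_apply, ENNReal.tsum_eq_zero.2, mul_zero]
    intro b
    rw [if_neg]
    intro h
    exact hy (Prod.ext_iff.1 h).1.symm

instance (π : M.Policy) : IsProbabilityMeasure (M.law π) := by
  unfold law; infer_instance

theorem law_apply_zero (π : M.Policy) {s : Set M.StateAction} :
    M.law π {ω | ω 0 ∈ s} = (M.withAction π M.augInit).toMeasure s := by
  have hs : MeasurableSet s := trivial
  have hH : MeasurableSet {h : Π _ : Finset.Iic 0, M.StateAction |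
      h ⟨0, Finset.mem_Iic.2 le_rfl⟩ ∈ s} :=
    measurable_pi_apply (⟨0, Finset.mem_Iic.2 le_rfl⟩ : Finset.Iic 0) hs
  have h1 : M.law π {ω | ω 0 ∈ s} = ((M.law π).map (Preorder.frestrictLe 0))
      {h | h ⟨0, Finset.mem_Iic.2 le_rfl⟩ ∈ s} := by
    rw [Measure.map_apply (by fun_prop) hH]
    rfl
  rw [h1, law, Kernel.trajMeasure, Measure.map_comp _ _ (by fun_prop),
    Kernel.traj_map_frestrictLe, Kernel.partialTraj_self, Measure.id_comp,
    Measure.map_apply (by fun_prop) hH]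
  rfl

theorem law_apply_succ (π : M.Policy) (t : ℕ) (z : M.StateAction) [MeasurableSingletonClass M.StateAction]
    (s : Set M.StateAction) :
    M.law π {ω | ω t = z ∧ ω (t + 1) ∈ s} =
      M.law π {ω | ω t = z} * (M.withAction π (M.augStep z.1 z.2)).toMeasure s := by
  have hs : MeasurableSet s := trivial
  have hz : MeasurableSet {z} := measurableSet_singleton z
  have h := Kernel.map_frestrictLe_trajMeasure_compProd_eq_map_trajMeasure
    (X := fun _ => M.StateAction)
    (μ₀ := (M.withAction π M.augInit).toMeasure) (κ := M.historyKernel π) (a := t)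
  set H : Set (Π _ : Finset.Iic t, M.StateAction) :=
    {h | h ⟨t, Finset.mem_Iic.2 le_rfl⟩ ∈ ({z} : Set _)} with hH
  have hHm : MeasurableSet H := measurable_pi_apply _ hz
  have h2 := congrArg (fun μ => μ (H ×ˢ s)) h
  beta_reduce at h2
  rw [Measure.compProd_apply_prod hHm hs, Measure.map_apply (by fun_prop) (hHm.prod hs)] at h2
  refine Eq.trans ?_ (h2.symm.trans ?_)
  · rfl
  · rw [setLIntegral_congr_fun (g := fun _ => (M.withAction π (M.augStep z.1 z.2)).toMeasure s) hHm,
      lintegral_const, Measure.restrict_apply_univ, Measure.map_apply (by fun_prop) hHm, mul_comm]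
    · rfl
    · intro h hh
      have : h ⟨t, Finset.mem_Iic.2 le_rfl⟩ = z := hh
      simp only [historyKernel, Kernel.comap_apply, this]
      rfl

variable [Fintype A] [Fintype M.AugSpace]

instance : Fintype M.StateAction := inferInstanceAs (Fintype (M.AugSpace × A))

instance : DiscreteMeasurableSpace M.StateAction := ⟨fun _ => trivial⟩

theorem sum_toReal {α : Type*} [Fintype α] (p : PMF α) : ∑ a, (p a).toReal = 1 := by
  rw [← ENNReal.toReal_sum fun a _ => p.apply_ne_top a, ← tsum_fintype (L := .unconditional α), p.tsum_coe,
    ENNReal.toReal_one]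

theorem withAction_toMeasure_singleton (π : M.Policy) (p : PMF M.AugSpace) (x : M.AugSpace)
    (a : A) : (M.withAction π p).toMeasure {((x, a) : M.AugSpace × A)} = p x * π x a :=
  (PMF.toMeasure_apply_singleton (M.withAction π p) ((x, a) : M.AugSpace × A) trivial).trans
    (M.withAction_apply π p x a)

theorem withAction_toMeasure_state (π : M.Policy) (p : PMF M.AugSpace) (x : M.AugSpace) :
    (M.withAction π p).toMeasure {z | z.1 = x} = p x := by
  classical
  refine (PMF.toMeasure_apply_fintype (M.withAction π p) {z | z.1 = x}).trans ?_
  refine (Fintype.sum_prod_type (α₁ := M.AugSpace) (α₂ := A) _).trans ?_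
  rw [Finset.sum_eq_single x]
  · have : ∀ a : A, Set.indicator {z : M.StateAction | z.1 = x} (M.withAction π p) (x, a) =
        p x * π x a := fun a => by
      rw [← withAction_apply]; exact Set.indicator_of_mem (by rfl) _
    rw [Finset.sum_congr rfl fun a _ => this a, ← Finset.mul_sum,
      ← tsum_fintype (L := .unconditional A), (π x).tsum_coe, mul_one]
  · intro y _ hy
    exact Finset.sum_eq_zero fun a _ => Set.indicator_of_notMem (by exact hy) _
  · simp

theorem law_apply_succ_eq_sum (π : M.Policy) (t : ℕ) (s : Set M.StateAction) :
    M.law π {ω | ω (t + 1) ∈ s} = ∑ z : M.StateAction,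
      M.law π {ω | ω t = z} * (M.withAction π (M.augStep z.1 z.2)).toMeasure s := by
  have hs : MeasurableSet s := trivial
  have h : {ω : ℕ → M.StateAction | ω (t + 1) ∈ s} =
      ⋃ z : M.StateAction, {ω | ω t = z ∧ ω (t + 1) ∈ s} := by
    ext ω; simp
  rw [h, measure_iUnion, tsum_fintype]
  · exact Finset.sum_congr rfl fun z _ => M.law_apply_succ π t z s
  · intro z z' hz
    rw [Function.onFun, Set.disjoint_left]
    rintro ω ⟨h1, _⟩ ⟨h2, _⟩
    exact hz (h1.symm.trans h2)
  · intro z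
    exact (measurable_pi_apply t (measurableSet_singleton z)).inter
      (measurable_pi_apply (X := fun _ => M.StateAction) (t + 1) hs)

/-- Law of the augmented state at time `t`. -/
def stateProb (π : M.Policy) (t : ℕ) (x : M.AugSpace) : ℝ := (M.law π).real {ω | (ω t).1 = x}

theorem law_real_eq (π : M.Policy) (t : ℕ) (x : M.AugSpace) (a : A) :
    (M.law π).real {ω | ω t = (x, a)} = M.stateProb π t x * (π x a).toReal := by
  rw [stateProb, measureReal_def, measureReal_def, ← ENNReal.toReal_mul]
  congr 1
  cases t with
  | zero =>
    refine (M.law_apply_zero π (s := {((x, a) : M.AugSpace × A)})).trans ?_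
    rw [withAction_toMeasure_singleton, ← M.withAction_toMeasure_state π, ← law_apply_zero]
    rfl
  | succ t =>
    refine (M.law_apply_succ_eq_sum π t {((x, a) : M.AugSpace × A)}).trans ?_
    have h := M.law_apply_succ_eq_sum π t {z | z.1 = x}
    refine Eq.trans ?_ (congrArg (· * π x a) h.symm)
    simp only [withAction_toMeasure_singleton, withAction_toMeasure_state, Finset.sum_mul,
      mul_assoc]

/-- Transition probabilities of the augmented process as real numbers. -/
def trans (x : M.AugSpace) (a : A) (y : M.AugSpace) : ℝ := (M.augStep x a y).toReal

theorem law_real_transition (π : M.Policy) (t : ℕ) (x : M.AugSpace) (a : A) (y : M.AugSpace) :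
    (M.law π).real {ω | ω t = (x, a) ∧ (ω (t + 1)).1 = y} =
      M.stateProb π t x * (π x a).toReal * M.trans x a y := by
  rw [← law_real_eq, trans, measureReal_def, measureReal_def, ← ENNReal.toReal_mul]
  congr 1
  rw [← M.withAction_toMeasure_state π (M.augStep x a) y]
  exact M.law_apply_succ π t (x, a) {z | z.1 = y}

theorem stateProb_zero (π : M.Policy) (x : M.AugSpace) :
    M.stateProb π 0 x = (M.augInit x).toReal := by
  rw [stateProb, measureReal_def, ← M.withAction_toMeasure_state π, ← law_apply_zero]
  rfl

theorem stateProb_succ (π : M.Policy) (t : ℕ) (y : M.AugSpace) :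
    M.stateProb π (t + 1) y =
      ∑ x, ∑ a, M.stateProb π t x * (π x a).toReal * M.trans x a y := by
  have h := M.law_apply_succ_eq_sum π t {z | z.1 = y}
  simp only [withAction_toMeasure_state] at h
  have h' := (congrArg ENNReal.toReal h).trans
    (ENNReal.toReal_sum fun z _ => ENNReal.mul_ne_top (measure_ne_top _ _) (PMF.apply_ne_top _ _))
  refine h'.trans ?_
  refine (Fintype.sum_prod_type (α₁ := M.AugSpace) (α₂ := A) _).trans ?_
  refine Finset.sum_congr rfl fun x _ => Finset.sum_congr rfl fun a _ => ?_
  rw [ENNReal.toReal_mul, ← law_real_eq]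
  rfl

theorem stateProb_nonneg (π : M.Policy) (t : ℕ) (x : M.AugSpace) : 0 ≤ M.stateProb π t x :=
  measureReal_nonneg

theorem stateProb_le_one (π : M.Policy) (t : ℕ) (x : M.AugSpace) : M.stateProb π t x ≤ 1 :=
  measureReal_le_one

theorem trans_nonneg (x : M.AugSpace) (a : A) (y : M.AugSpace) : 0 ≤ M.trans x a y :=
  ENNReal.toReal_nonneg

theorem sum_trans (x : M.AugSpace) (a : A) : ∑ y, M.trans x a y = 1 := sum_toReal _

theorem summable_pow_mul {γ : ℝ} (h0 : 0 ≤ γ) (h1 : γ < 1) {f : ℕ → ℝ} {B : ℝ} (hf : ∀ t, |f t| ≤ B) :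
    Summable fun t => γ ^ t * f t := by
  refine Summable.of_norm_bounded ((summable_geometric_of_lt_one h0 h1).mul_right B) fun t => ?_
  rw [Real.norm_eq_abs, abs_mul, abs_of_nonneg (pow_nonneg h0 t)]
  exact mul_le_mul_of_nonneg_left (hf t) (pow_nonneg h0 t)

theorem summable_stateProb (π : M.Policy) (x : M.AugSpace) :
    Summable fun t => M.γ ^ t * M.stateProb π t x :=
  summable_pow_mul M.γ_pos.le M.γ_lt_one (B := 1) fun t => by
    rw [abs_of_nonneg (M.stateProb_nonneg π t x)]; exact M.stateProb_le_one π t x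

theorem occupancy_eq (π : M.Policy) (x : M.AugSpace) :
    M.occupancy π x = (1 - M.γ) * ∑' t : ℕ, M.γ ^ t * M.stateProb π t x := rfl

theorem occupancy_nonneg (π : M.Policy) (x : M.AugSpace) : 0 ≤ M.occupancy π x :=
  mul_nonneg (sub_nonneg.2 M.γ_lt_one.le) <| tsum_nonneg fun t =>
    mul_nonneg (pow_nonneg M.γ_pos.le t) (M.stateProb_nonneg π t x)

/-- The occupancy measure satisfies the flow equations. -/
theorem occupancy_flow (π : M.Policy) (y : M.AugSpace) :
    M.occupancy π y = (1 - M.γ) * (M.augInit y).toReal +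
      M.γ * ∑ x, ∑ a, M.occupancy π x * (π x a).toReal * M.trans x a y := by
  rw [occupancy_eq, (M.summable_stateProb π y).tsum_eq_zero_add, stateProb_zero, pow_zero, one_mul,
    mul_add]
  congr 1
  have h : ∀ t, M.γ ^ (t + 1) * M.stateProb π (t + 1) y =
      ∑ x, ∑ a, M.γ * (M.γ ^ t * M.stateProb π t x) * ((π x a).toReal * M.trans x a y) := fun t => by
    rw [stateProb_succ, Finset.mul_sum]
    refine Finset.sum_congr rfl fun x _ => ?_
    rw [Finset.mul_sum]
    refine Finset.sum_congr rfl fun a _ => ?_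
    ring
  have hs : ∀ x a, Summable fun t => M.γ * (M.γ ^ t * M.stateProb π t x) *
      ((π x a).toReal * M.trans x a y) := fun x a =>
    ((M.summable_stateProb π x).mul_left _).mul_right _
  rw [tsum_congr h, Summable.tsum_finsetSum fun x _ => summable_sum fun a _ => hs x a,
    Finset.mul_sum, Finset.mul_sum]
  refine Finset.sum_congr rfl fun x _ => ?_
  rw [Summable.tsum_finsetSum fun a _ => hs x a, Finset.mul_sum, Finset.mul_sum]
  refine Finset.sum_congr rfl fun a _ => ?_
  rw [tsum_mul_right, tsum_mul_left, occupancy_eq]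
  ring

theorem sum_occupancy (π : M.Policy) : ∑ x, M.occupancy π x = 1 := by
  have h : ∑ y, M.occupancy π y = (1 - M.γ) + M.γ * ∑ x, M.occupancy π x := by
    conv_lhs => rw [Finset.sum_congr rfl fun y _ => M.occupancy_flow π y]
    rw [Finset.sum_add_distrib, ← Finset.mul_sum, ← Finset.mul_sum, sum_toReal, mul_one,
      Finset.sum_comm]
    congr 2
    refine Finset.sum_congr rfl fun x _ => ?_
    rw [Finset.sum_comm]
    simp only [← Finset.mul_sum, sum_trans, mul_one, sum_toReal]
  have := M.γ_lt_one
  nlinarith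

theorem augInit_pos (s : S) (hs : s ∈ M.ρ.support) :
    0 < (M.augInit ⟨⟨s, fun _ => 0, 1⟩, Reachable.init s hs⟩).toReal := by
  refine ENNReal.toReal_pos ?_ (PMF.apply_ne_top _ _)
  rw [← PMF.mem_support_iff, augInit, PMF.mem_support_bindOnSupport_iff]
  exact ⟨s, hs, by simp⟩

theorem trans_pos (x : M.AugSpace) (a : A) (s' : S) (hs' : s' ∈ (M.P x.1.s a).support) :
    0 < M.trans x a ⟨M.next x.1 a s', Reachable.step x.1 a s' x.2 hs'⟩ := by
  refine ENNReal.toReal_pos ?_ (PMF.apply_ne_top _ _)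
  rw [← PMF.mem_support_iff, augStep, PMF.mem_support_bindOnSupport_iff]
  exact ⟨s', hs', by simp⟩

theorem eq_next_of_trans_ne_zero {x : M.AugSpace} {a : A} {y : M.AugSpace}
    (h : M.trans x a y ≠ 0) :
    y.1.s ∈ (M.P x.1.s a).support ∧ y.1 = M.next x.1 a y.1.s := by
  have h1 : y ∈ (M.augStep x a).support := by
    rw [PMF.mem_support_iff]
    intro h0
    exact h (by rw [trans, h0, ENNReal.toReal_zero])
  rw [augStep, PMF.mem_support_bindOnSupport_iff] at h1
  obtain ⟨s', hs', hy⟩ := h1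
  rw [PMF.mem_support_pure_iff] at hy
  have : y.1.s = s' := by
    rw [hy]
    simp only [next]
    split_ifs <;> rfl
  subst this
  exact ⟨hs', congrArg Subtype.val hy⟩

theorem eq_of_augInit_ne_zero {x : M.AugSpace} (h : (M.augInit x).toReal ≠ 0) :
    x.1 = ⟨x.1.s, fun _ => 0, 1⟩ := by
  have h1 : x ∈ M.augInit.support := by
    rw [PMF.mem_support_iff]
    intro h0
    exact h (by rw [h0, ENNReal.toReal_zero])
  rw [augInit, PMF.mem_support_bindOnSupport_iff] at h1
  obtain ⟨s, hs, hx⟩ := h1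
  rw [PMF.mem_support_pure_iff] at hx
  rw [hx]

/-- A policy that plays every action visits every augmented state. -/
theorem occupancy_pos (π : M.Policy) (hπ : ∀ x a, 0 < (π x a).toReal) (x : M.AugSpace) :
    0 < M.occupancy π x := by
  obtain ⟨x, hx⟩ := x
  induction hx with
  | init s hs =>
    rw [occupancy_flow]
    refine add_pos_of_pos_of_nonneg (mul_pos (sub_pos.2 M.γ_lt_one) (M.augInit_pos s hs)) ?_
    exact mul_nonneg M.γ_pos.le <| Finset.sum_nonneg fun x _ => Finset.sum_nonneg fun a _ =>
      mul_nonneg (mul_nonneg (M.occupancy_nonneg _ _) ENNReal.toReal_nonneg) (M.trans_nonneg _ _ _)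
  | step x a s' hx hs' ih =>
    rw [occupancy_flow]
    refine add_pos_of_nonneg_of_pos
      (mul_nonneg (sub_nonneg.2 M.γ_lt_one.le) ENNReal.toReal_nonneg) (mul_pos M.γ_pos ?_)
    have h0 : ∀ x a, 0 ≤ M.occupancy π x * (π x a).toReal *
        M.trans x a ⟨M.next _ _ s', Reachable.step _ _ s' hx hs'⟩ := fun x a =>
      mul_nonneg (mul_nonneg (M.occupancy_nonneg _ _) ENNReal.toReal_nonneg) (M.trans_nonneg _ _ _)
    refine Finset.sum_pos' (fun x _ => Finset.sum_nonneg fun a _ => h0 x a)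
      ⟨⟨x, hx⟩, Finset.mem_univ _, Finset.sum_pos' (fun a _ => h0 _ a) ⟨a, Finset.mem_univ _, ?_⟩⟩
    exact mul_pos (mul_pos ih (hπ _ _)) (M.trans_pos ⟨x, hx⟩ a s' hs')

end CMDP
end
end RiskRL

namespace RiskRL
noncomputable section
namespace CMDP

set_option linter.unusedSectionVars false

variable {S A : Type*} {N : ℕ} (M : CMDP S A N) [Fintype A] [Fintype M.AugSpace]

/-- Discounted return of a reward on augmented transitions. -/
def augReturn (r : M.AugSpace → A → M.AugSpace → ℝ) (ω : ℕ → M.StateAction) : ℝ :=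
  ∑' t : ℕ, M.γ ^ t * r (ω t).1 (ω t).2 (ω (t + 1)).1

/-- Expected reward of a state-action pair. -/
def meanReward (r : M.AugSpace → A → M.AugSpace → ℝ) (x : M.AugSpace) (a : A) : ℝ :=
  ∑ y, M.trans x a y * r x a y

/-- Expected discounted return of the policy `π` for the reward `r`. -/
def value (r : M.AugSpace → A → ℝ) (π : M.Policy) : ℝ :=
  (∑ x, M.occupancy π x * ∑ a, (π x a).toReal * r x a) / (1 - M.γ)

theorem measurableSet_transition (t : ℕ) (x : M.AugSpace) (a : A) (y : M.AugSpace) :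
    MeasurableSet {ω : ℕ → M.StateAction | ω t = (x, a) ∧ (ω (t + 1)).1 = y} :=
  (measurable_pi_apply (X := fun _ => M.StateAction) t
    (show MeasurableSet {z : M.StateAction | z = (x, a)} from trivial)).inter
    (measurable_pi_apply (X := fun _ => M.StateAction) (t + 1)
      (show MeasurableSet {z : M.StateAction | z.1 = y} from trivial))

theorem eq_sum_indicator (r : M.AugSpace → A → M.AugSpace → ℝ) (t : ℕ) (ω : ℕ → M.StateAction) :
    r (ω t).1 (ω t).2 (ω (t + 1)).1 = ∑ x, ∑ a, ∑ y,
      Set.indicator {ω : ℕ → M.StateAction | ω t = (x, a) ∧ (ω (t + 1)).1 = y}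
        (fun _ => r x a y) ω := by
  classical
  rw [Finset.sum_eq_single (ω t).1, Finset.sum_eq_single (ω t).2,
    Finset.sum_eq_single (ω (t + 1)).1]
  · rw [Set.indicator_of_mem]
    exact ⟨rfl, rfl⟩
  · intro y _ hy
    exact Set.indicator_of_notMem (fun h => hy h.2.symm) _
  · simp
  · intro a _ ha
    exact Finset.sum_eq_zero fun y _ => Set.indicator_of_notMem
      (fun h => ha (congrArg Prod.snd h.1).symm) _
  · simp
  · intro x _ hx
    exact Finset.sum_eq_zero fun a _ => Finset.sum_eq_zero fun y _ => Set.indicator_of_notMem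
      (fun h => hx (congrArg Prod.fst h.1).symm) _
  · simp

theorem integrable_transition (r : M.AugSpace → A → M.AugSpace → ℝ) (π : M.Policy) (t : ℕ) :
    Integrable (fun ω => r (ω t).1 (ω t).2 (ω (t + 1)).1) (M.law π) := by
  rw [funext (M.eq_sum_indicator r t)]
  exact integrable_finsetSum _ fun x _ => integrable_finsetSum _ fun a _ =>
    integrable_finsetSum _ fun y _ =>
      (integrable_const _).indicator (M.measurableSet_transition t x a y)

theorem integral_transition (r : M.AugSpace → A → M.AugSpace → ℝ) (π : M.Policy) (t : ℕ) :
    ∫ ω, r (ω t).1 (ω t).2 (ω (t + 1)).1 ∂(M.law π) =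
      ∑ x, M.stateProb π t x * ∑ a, (π x a).toReal * M.meanReward r x a := by
  have hi : ∀ x a y, Integrable (Set.indicator
      {ω : ℕ → M.StateAction | ω t = (x, a) ∧ (ω (t + 1)).1 = y} (fun _ => r x a y)) (M.law π) :=
    fun x a y => (integrable_const _).indicator (M.measurableSet_transition t x a y)
  rw [funext (M.eq_sum_indicator r t), integral_finsetSum _ fun x _ =>
    integrable_finsetSum _ fun a _ => integrable_finsetSum _ fun y _ => hi x a y]
  refine Finset.sum_congr rfl fun x _ => ?_
  rw [integral_finsetSum _ fun a _ => integrable_finsetSum _ fun y _ => hi x a y, Finset.mul_sum]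
  refine Finset.sum_congr rfl fun a _ => ?_
  rw [integral_finsetSum _ fun y _ => hi x a y, meanReward, Finset.mul_sum, Finset.mul_sum]
  refine Finset.sum_congr rfl fun y _ => ?_
  rw [integral_indicator_const _ (M.measurableSet_transition t x a y), law_real_transition,
    smul_eq_mul]
  ring

theorem exists_abs_le (r : M.AugSpace → A → M.AugSpace → ℝ) : ∃ B, ∀ x a y, |r x a y| ≤ B :=
  ⟨∑ x, ∑ a, ∑ y, |r x a y|, fun x a y =>
    (Finset.single_le_sum (f := fun y => |r x a y|) (fun _ _ => abs_nonneg _)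
      (Finset.mem_univ y)).trans <|
    (Finset.single_le_sum (f := fun a => ∑ y, |r x a y|)
      (fun _ _ => Finset.sum_nonneg fun _ _ => abs_nonneg _) (Finset.mem_univ a)).trans <|
    Finset.single_le_sum (f := fun x => ∑ a, ∑ y, |r x a y|)
      (fun _ _ => Finset.sum_nonneg fun _ _ => Finset.sum_nonneg fun _ _ => abs_nonneg _)
      (Finset.mem_univ x)⟩

theorem summable_augReturn (r : M.AugSpace → A → M.AugSpace → ℝ) (ω : ℕ → M.StateAction) :
    Summable fun t => M.γ ^ t * r (ω t).1 (ω t).2 (ω (t + 1)).1 := by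
  obtain ⟨B, hB⟩ := M.exists_abs_le r
  exact summable_pow_mul M.γ_pos.le M.γ_lt_one fun t => hB _ _ _

theorem integrable_augReturn (r : M.AugSpace → A → M.AugSpace → ℝ) (π : M.Policy) :
    Integrable (M.augReturn r) (M.law π) := by
  obtain ⟨B, hB⟩ := M.exists_abs_le r
  have hs := fun ω => M.summable_augReturn r ω
  refine Integrable.of_bound (C := ∑' t, M.γ ^ t * B) ?_ (Eventually.of_forall fun ω => ?_)
  · have hm : ∀ n, AEStronglyMeasurable (fun ω : ℕ → M.StateAction =>
        ∑ t ∈ Finset.range n, M.γ ^ t * r (ω t).1 (ω t).2 (ω (t + 1)).1) (M.law π) := fun n =>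
      (integrable_finsetSum _ fun t _ =>
        (M.integrable_transition r π t).const_mul (M.γ ^ t)).aestronglyMeasurable
    have ht : ∀ ω : ℕ → M.StateAction, Tendsto (fun n =>
        ∑ t ∈ Finset.range n, M.γ ^ t * r (ω t).1 (ω t).2 (ω (t + 1)).1) atTop
        (𝓝 (M.augReturn r ω)) := fun ω => (hs ω).hasSum.tendsto_sum_nat
    exact aestronglyMeasurable_of_tendsto_ae atTop hm (Eventually.of_forall ht)
  · refine tsum_of_norm_bounded (f := fun t => M.γ ^ t * r (ω t).1 (ω t).2 (ω (t + 1)).1)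
      ((summable_geometric_of_lt_one M.γ_pos.le M.γ_lt_one).mul_right B).hasSum fun t => ?_
    rw [norm_mul, Real.norm_of_nonneg (pow_nonneg M.γ_pos.le t)]
    exact mul_le_mul_of_nonneg_left (hB _ _ _) (pow_nonneg M.γ_pos.le t)

theorem integral_augReturn (r : M.AugSpace → A → M.AugSpace → ℝ) (π : M.Policy) :
    ∫ ω, M.augReturn r ω ∂(M.law π) = M.value (M.meanReward r) π := by
  obtain ⟨B, hB⟩ := M.exists_abs_le r
  have hγ : 1 - M.γ ≠ 0 := (sub_pos.2 M.γ_lt_one).ne'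
  have hi : ∀ t, Integrable (fun ω => M.γ ^ t * r (ω t).1 (ω t).2 (ω (t + 1)).1) (M.law π) :=
    fun t => (M.integrable_transition r π t).const_mul _
  have hs : Summable fun t => ∫ ω, ‖M.γ ^ t * r (ω t).1 (ω t).2 (ω (t + 1)).1‖ ∂(M.law π) := by
    refine Summable.of_nonneg_of_le (fun t => integral_nonneg fun _ => norm_nonneg _) (fun t => ?_)
      ((summable_geometric_of_lt_one M.γ_pos.le M.γ_lt_one).mul_right B)
    refine (integral_mono (hi t).norm (integrable_const (M.γ ^ t * B)) fun ω => ?_).trans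
      (by simp)
    change ‖M.γ ^ t * r (ω t).1 (ω t).2 (ω (t + 1)).1‖ ≤ M.γ ^ t * B
    rw [norm_mul, Real.norm_of_nonneg (pow_nonneg M.γ_pos.le t)]
    exact mul_le_mul_of_nonneg_left (hB _ _ _) (pow_nonneg M.γ_pos.le t)
  unfold augReturn
  rw [← integral_tsum_of_summable_integral_norm hi hs, value, eq_div_iff hγ]
  have h : ∀ t, ∫ ω, M.γ ^ t * r (ω t).1 (ω t).2 (ω (t + 1)).1 ∂(M.law π) =
      ∑ x, M.γ ^ t * M.stateProb π t x * ∑ a, (π x a).toReal * M.meanReward r x a := fun t => by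
    rw [integral_const_mul, integral_transition, Finset.mul_sum]
    exact Finset.sum_congr rfl fun x _ => (mul_assoc _ _ _).symm
  rw [tsum_congr h, Summable.tsum_finsetSum fun x _ => (M.summable_stateProb π x).mul_right _,
    Finset.sum_mul]
  refine Finset.sum_congr rfl fun x _ => ?_
  rw [tsum_mul_right, occupancy_eq]
  ring

/-- The reward of the augmented process as a function of state-action pairs. -/
def rewardR : M.AugSpace → A → ℝ := M.meanReward fun x a y => M.R x.1.s a y.1.s

theorem JR_eq_value (π : M.Policy) : M.JR π = M.value M.rewardR π :=
  M.integral_augReturn (fun x a y => M.R x.1.s a y.1.s) π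

theorem ae_transition (π : M.Policy) :
    ∀ᵐ ω ∂(M.law π), ∀ t, M.trans (ω t).1 (ω t).2 (ω (t + 1)).1 ≠ 0 := by
  rw [ae_all_iff]
  intro t
  have h : ∀ x a y, M.trans x a y = 0 → M.law π {ω | ω t = (x, a) ∧ (ω (t + 1)).1 = y} = 0 := by
    intro x a y h0
    have := M.law_real_transition π t x a y
    rwa [h0, mul_zero, measureReal_eq_zero_iff] at this
  have h2 : ∀ᵐ ω ∂(M.law π), ∀ x a y, M.trans x a y = 0 →
      ¬ (ω t = (x, a) ∧ (ω (t + 1)).1 = y) := by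
    rw [ae_all_iff]; intro x
    rw [ae_all_iff]; intro a
    rw [ae_all_iff]; intro y
    by_cases h0 : M.trans x a y = 0
    · exact (measure_eq_zero_iff_ae_notMem.1 (h x a y h0)).mono fun ω hω _ => hω
    · exact Eventually.of_forall fun ω h => absurd h h0
  filter_upwards [h2] with ω hω h0
  exact hω _ _ _ h0 ⟨rfl, rfl⟩

theorem ae_augInit (π : M.Policy) : ∀ᵐ ω ∂(M.law π), (M.augInit (ω 0).1).toReal ≠ 0 := by
  have h2 : ∀ᵐ ω ∂(M.law π), ∀ x, (M.augInit x).toReal = 0 → (ω 0).1 ≠ x := by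
    rw [ae_all_iff]; intro x
    by_cases h0 : (M.augInit x).toReal = 0
    · have := M.stateProb_zero π x
      rw [h0, stateProb, measureReal_eq_zero_iff] at this
      rw [ae_iff]
      simpa [h0] using this
    · exact Eventually.of_forall fun ω h => absurd h h0
  filter_upwards [h2] with ω hω h0
  exact hω _ h0 rfl

open Classical in
/-- Reward whose discounted return is, up to the constant `g 0`, the function `g` of the return of
the cost `C i`. -/
def transCost (g : ℝ → ℝ) (i : Fin N) (x : M.AugSpace) (_ : A) (y : M.AugSpace) : ℝ :=
  if x.1.s ∈ M.costFree then 0 else (g (y.1.b * y.1.e i) - g (x.1.b * x.1.e i)) / x.1.b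

theorem comp_discReturn_eq {g : ℝ → ℝ} (hg : Continuous g) (i : Fin N) {ω : ℕ → M.StateAction}
    (h0 : (M.augInit (ω 0).1).toReal ≠ 0)
    (hω : ∀ t, M.trans (ω t).1 (ω t).2 (ω (t + 1)).1 ≠ 0) :
    g (M.discReturn (M.C i) ω) = g 0 + M.augReturn (M.transCost g i) ω := by
  have hn := fun t => M.eq_next_of_trans_ne_zero (hω t)
  have hi := M.eq_of_augInit_ne_zero h0
  have hb : ∀ t, (ω t).1.1.s ∉ M.costFree → (ω t).1.1.b = M.γ ^ t := by
    intro t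
    induction t with
    | zero => intro _; rw [hi, pow_zero]
    | succ t ih =>
      intro h
      have hx : (ω t).1.1.s ∉ M.costFree := fun hx => h (M.costFree_closed _ hx _ _ (hn t).1)
      rw [(hn t).2, next, if_neg hx]
      change M.γ * (ω t).1.1.b = _
      rw [ih hx, pow_succ']
  set Z : ℕ → ℝ := fun t => (ω t).1.1.b * (ω t).1.1.e i with hZ
  have hZ0 : Z 0 = 0 := by
    simp only [hZ]; rw [hi, mul_zero]
  have hγ := M.γ_pos.ne'
  have hZs : ∀ t, Z (t + 1) = Z t + M.γ ^ t * M.C i (ω t).1.1.s (ω t).2 (ω (t + 1)).1.1.s := by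
    intro t
    by_cases hx : (ω t).1.1.s ∈ M.costFree
    · rw [M.costFree_cost i _ hx, mul_zero, add_zero]
      simp only [hZ]
      rw [(hn t).2, next, if_pos hx]
    · simp only [hZ]
      conv_lhs => rw [(hn t).2, next, if_neg hx]
      change M.γ * (ω t).1.1.b * ((M.C i _ _ _ + (ω t).1.1.e i) / M.γ) = _
      rw [← hb t hx]
      field_simp
      ring
  have hlim : Tendsto Z atTop (𝓝 (M.discReturn (M.C i) ω)) := by
    have h := (M.summable_augReturn (fun x a y => M.C i x.1.s a y.1.s) ω).hasSum.tendsto_sum_nat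
    refine h.congr fun n => ?_
    induction n with
    | zero => rw [Finset.sum_range_zero, hZ0]
    | succ n ih => rw [Finset.sum_range_succ, ih, hZs]
  have hsum := (M.summable_augReturn (M.transCost g i) ω).hasSum.tendsto_sum_nat
  have h2 : Tendsto (fun t => g (Z t) - g 0) atTop
      (𝓝 (g (M.discReturn (M.C i) ω) - g 0)) :=
    ((hg.tendsto _).comp hlim).sub_const _
  have h3 := tendsto_nhds_unique (h2.congr fun n => ?_) hsum
  · rw [augReturn, ← h3]; ring
  · induction n with
    | zero => rw [Finset.sum_range_zero, hZ0, sub_self]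
    | succ n ih =>
      rw [Finset.sum_range_succ, ← ih, transCost]
      split_ifs with hx
      · rw [hZs, M.costFree_cost i _ hx]; simp
      · rw [← hb n hx]
        change g (Z (n + 1)) - g 0 = g (Z n) - g 0 + (ω n).1.1.b * ((g (Z (n + 1)) - g (Z n)) / (ω n).1.1.b)
        rw [hb n hx]
        field_simp
        ring

/-- The cost of the `i`-th constraint as a function of state-action pairs. -/
def rewardC (g : Fin N → ℝ → ℝ) (i : Fin N) : M.AugSpace → A → ℝ :=
  M.meanReward (M.transCost (g i) i)

/-- Each constraint function is an affine function of the occupancy measure. -/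
theorem JC_eq_value (σ g : Fin N → ℝ → ℝ) (i : Fin N) (hg : ConvexOn ℝ Set.univ (g i))
    (π : M.Policy) : M.JC σ g i π =
      M.value (M.rewardC g i) π + (g i 0 + ∫ u in (0 : ℝ)..1, conj (g i) (σ i u)) := by
  have hc : Continuous (g i) := by
    rw [← continuousOn_univ]
    exact hg.continuousOn isOpen_univ
  have h : ∫ ω, g i (M.discReturn (M.C i) ω) ∂(M.law π) =
      ∫ ω, (g i 0 + M.augReturn (M.transCost (g i) i) ω) ∂(M.law π) := by
    refine integral_congr_ae ?_
    filter_upwards [M.ae_augInit π, M.ae_transition π] with ω h0 hω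
    exact M.comp_discReturn_eq hc i h0 hω
  rw [JC, subRisk, h, integral_add (integrable_const _) (M.integrable_augReturn _ π), integral_augReturn, rewardC]
  simp only [integral_const, probReal_univ, one_smul]
  ring
end CMDP
end
end RiskRL

namespace RiskRL
noncomputable section
namespace CMDP

set_option linter.unusedSectionVars false

variable {S A : Type*} {N : ℕ} (M : CMDP S A N) [Fintype A] [Fintype M.AugSpace]

theorem abs_sum_mul_le {ι : Type*} [Fintype ι] {p f : ι → ℝ} {B : ℝ} (hp : ∀ i, 0 ≤ p i)
    (hp1 : ∑ i, p i = 1) (hf : ∀ i, |f i| ≤ B) : |∑ i, p i * f i| ≤ B := by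
  calc |∑ i, p i * f i| ≤ ∑ i, |p i * f i| := Finset.abs_sum_le_sum_abs _ _
    _ ≤ ∑ i, p i * B := Finset.sum_le_sum fun i _ => by
        rw [abs_mul, abs_of_nonneg (hp i)]
        exact mul_le_mul_of_nonneg_left (hf i) (hp i)
    _ = B := by rw [← Finset.sum_mul, hp1, one_mul]

/-- The Bellman equation of a policy has a solution. -/
theorem exists_bellman (r : M.AugSpace → A → ℝ) (π : M.Policy) :
    ∃ v : M.AugSpace → ℝ, ∀ x, v x =
      ∑ a, (π x a).toReal * (r x a + M.γ * ∑ y, M.trans x a y * v y) := by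
  set T : (M.AugSpace → ℝ) → (M.AugSpace → ℝ) := fun v x =>
    ∑ a, (π x a).toReal * (r x a + M.γ * ∑ y, M.trans x a y * v y) with hT
  have hc : ContractingWith ⟨M.γ, M.γ_pos.le⟩ T := by
    refine ⟨by exact_mod_cast M.γ_lt_one, LipschitzWith.of_dist_le_mul fun v w => ?_⟩
    refine (dist_pi_le_iff (mul_nonneg M.γ_pos.le dist_nonneg)).2 fun x => ?_
    have h : T v x - T w x =
        ∑ a, (π x a).toReal * (M.γ * ∑ y, M.trans x a y * (v y - w y)) := by
      simp only [hT]
      rw [← Finset.sum_sub_distrib]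
      refine Finset.sum_congr rfl fun a _ => ?_
      simp only [mul_sub, Finset.sum_sub_distrib]
      ring
    rw [Real.dist_eq, h]
    refine abs_sum_mul_le (fun _ => ENNReal.toReal_nonneg) (sum_toReal _) fun a => ?_
    rw [abs_mul, abs_of_pos M.γ_pos]
    refine mul_le_mul_of_nonneg_left ?_ M.γ_pos.le
    exact abs_sum_mul_le (M.trans_nonneg x a) (M.sum_trans x a) fun y => dist_le_pi_dist v w y
  exact ⟨hc.fixedPoint, fun x => (congrFun hc.fixedPoint_isFixedPt x).symm⟩

/-- State value function of the policy `π`. -/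
def stateValue (r : M.AugSpace → A → ℝ) (π : M.Policy) : M.AugSpace → ℝ :=
  (M.exists_bellman r π).choose

/-- Action value function of the policy `π`. -/
def actionValue (r : M.AugSpace → A → ℝ) (π : M.Policy) (x : M.AugSpace) (a : A) : ℝ :=
  r x a + M.γ * ∑ y, M.trans x a y * M.stateValue r π y

/-- Advantage function of the policy `π`. -/
def advantage (r : M.AugSpace → A → ℝ) (π : M.Policy) (x : M.AugSpace) (a : A) : ℝ :=
  M.actionValue r π x a - M.stateValue r π x

theorem stateValue_eq (r : M.AugSpace → A → ℝ) (π : M.Policy) (x : M.AugSpace) :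
    M.stateValue r π x = ∑ a, (π x a).toReal * M.actionValue r π x a :=
  (M.exists_bellman r π).choose_spec x

theorem sum_mul_advantage (r : M.AugSpace → A → ℝ) (π : M.Policy) (x : M.AugSpace) :
    ∑ a, (π x a).toReal * M.advantage r π x a = 0 := by
  simp only [advantage, mul_sub, Finset.sum_sub_distrib]
  rw [← Finset.sum_mul, sum_toReal, one_mul, ← stateValue_eq, sub_self]

theorem abs_stateValue_le {r : M.AugSpace → A → ℝ} {B : ℝ} (hB : ∀ x a, |r x a| ≤ B)
    (π : M.Policy) (x : M.AugSpace) : |M.stateValue r π x| ≤ B / (1 - M.γ) := by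
  have hγ : 0 < 1 - M.γ := sub_pos.2 M.γ_lt_one
  obtain ⟨y, -, hy⟩ := Finset.exists_max_image Finset.univ (fun y => |M.stateValue r π y|)
    ⟨x, Finset.mem_univ x⟩
  have h : |M.stateValue r π y| ≤ B + M.γ * |M.stateValue r π y| := by
    conv_lhs => rw [stateValue_eq]
    refine abs_sum_mul_le (fun _ => ENNReal.toReal_nonneg) (sum_toReal _) fun a => ?_
    refine (abs_add_le _ _).trans (add_le_add (hB y a) ?_)
    rw [abs_mul, abs_of_pos M.γ_pos]
    exact mul_le_mul_of_nonneg_left (abs_sum_mul_le (M.trans_nonneg y a) (M.sum_trans y a)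
      fun z => hy z (Finset.mem_univ z)) M.γ_pos.le
  refine (hy x (Finset.mem_univ x)).trans ?_
  rw [le_div_iff₀ hγ]
  linarith

theorem abs_advantage_le {r : M.AugSpace → A → ℝ} {B : ℝ} (hB : ∀ x a, |r x a| ≤ B)
    (π : M.Policy) (x : M.AugSpace) (a : A) : |M.advantage r π x a| ≤ 2 * (B / (1 - M.γ)) := by
  have hγ : 0 < 1 - M.γ := sub_pos.2 M.γ_lt_one
  have h1 : |∑ y, M.trans x a y * M.stateValue r π y| ≤ B / (1 - M.γ) :=
    abs_sum_mul_le (M.trans_nonneg x a) (M.sum_trans x a) (M.abs_stateValue_le hB π)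
  have h2 := M.abs_stateValue_le hB π x
  have h3 : |M.γ * ∑ y, M.trans x a y * M.stateValue r π y| ≤ M.γ * (B / (1 - M.γ)) := by
    rw [abs_mul, abs_of_pos M.γ_pos]
    exact mul_le_mul_of_nonneg_left h1 M.γ_pos.le
  have h4 : B + M.γ * (B / (1 - M.γ)) = B / (1 - M.γ) := by field_simp; ring
  have h5 := (abs_add_le (r x a) (M.γ * ∑ y, M.trans x a y * M.stateValue r π y)).trans
    (add_le_add (hB x a) h3)
  refine (abs_sub _ _).trans ?_
  rw [actionValue]
  linarith

/-- Value of `π'` in terms of the advantage function of `π`. -/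
theorem value_eq_advantage (r : M.AugSpace → A → ℝ) (π π' : M.Policy) :
    M.value r π' = (∑ x, M.occupancy π' x * ∑ a, (π' x a).toReal * M.advantage r π x a) /
      (1 - M.γ) + ∑ x, (M.augInit x).toReal * M.stateValue r π x := by
  have hγ : 1 - M.γ ≠ 0 := (sub_pos.2 M.γ_lt_one).ne'
  set v := M.stateValue r π with hv
  have h1 : ∑ y, M.occupancy π' y * v y = (1 - M.γ) * ∑ y, (M.augInit y).toReal * v y +
      ∑ x, M.occupancy π' x * ∑ a, (π' x a).toReal * (M.γ * ∑ y, M.trans x a y * v y) := by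
    conv_lhs => rw [Finset.sum_congr rfl fun y _ => congrArg (· * v y) (M.occupancy_flow π' y)]
    simp only [add_mul, Finset.sum_add_distrib, Finset.mul_sum, Finset.sum_mul]
    congr 1
    · exact Finset.sum_congr rfl fun _ _ => by ring
    · rw [Finset.sum_comm]
      refine Finset.sum_congr rfl fun x _ => ?_
      rw [Finset.sum_comm]
      exact Finset.sum_congr rfl fun _ _ => Finset.sum_congr rfl fun _ _ => by ring
  have h2 : ∑ x, M.occupancy π' x * ∑ a, (π' x a).toReal * M.advantage r π x a =
      ∑ x, M.occupancy π' x * ∑ a, (π' x a).toReal * r x a +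
      ∑ x, M.occupancy π' x * ∑ a, (π' x a).toReal * (M.γ * ∑ y, M.trans x a y * v y) -
      ∑ x, M.occupancy π' x * v x := by
    rw [← Finset.sum_add_distrib, ← Finset.sum_sub_distrib]
    refine Finset.sum_congr rfl fun x _ => ?_
    rw [← mul_add, ← mul_sub, ← Finset.sum_add_distrib]
    congr 1
    have : v x = ∑ a, (π' x a).toReal * v x := by rw [← Finset.sum_mul, sum_toReal, one_mul]
    rw [this, ← Finset.sum_sub_distrib]
    refine Finset.sum_congr rfl fun a _ => ?_
    rw [advantage, actionValue]
    ring
  rw [value, div_add' _ _ _ hγ]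
  congr 1
  rw [h2, h1]
  ring

/-- The performance difference lemma. -/
theorem value_sub_value (r : M.AugSpace → A → ℝ) (π π' : M.Policy) :
    M.value r π' - M.value r π =
      (∑ x, M.occupancy π' x * ∑ a, (π' x a).toReal * M.advantage r π x a) / (1 - M.γ) := by
  rw [M.value_eq_advantage r π π', M.value_eq_advantage r π π]
  simp only [sum_mul_advantage, mul_zero, Finset.sum_const_zero, zero_div, zero_add]
  ring

theorem exists_abs_reward_le (r : M.AugSpace → A → ℝ) : ∃ B, ∀ x a, |r x a| ≤ B := by
  obtain ⟨B, hB⟩ := M.exists_abs_le fun x a _ => r x a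
  exact ⟨B, fun x a => hB x a x⟩

/-- The value is continuous in the policy on the states visited by the limit policy. -/
theorem tendsto_value (r : M.AugSpace → A → ℝ) {ι : Type*} {l : Filter ι} {π : ι → M.Policy}
    {π₀ : M.Policy} (h : ∀ x, 0 < M.occupancy π₀ x → ∀ a,
      Tendsto (fun i => (π i x a).toReal) l (𝓝 (π₀ x a).toReal)) :
    Tendsto (fun i => M.value r (π i)) l (𝓝 (M.value r π₀)) := by
  obtain ⟨B, hB⟩ := M.exists_abs_reward_le r
  have key : Tendsto (fun i => M.value r π₀ - M.value r (π i)) l (𝓝 0) := by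
    have h1 : ∀ i, M.value r π₀ - M.value r (π i) = (∑ x, M.occupancy π₀ x *
        ∑ a, ((π₀ x a).toReal - (π i x a).toReal) * M.advantage r (π i) x a) / (1 - M.γ) := fun i => by
      rw [value_sub_value]
      simp only [sub_mul, Finset.sum_sub_distrib, sum_mul_advantage, sub_zero]
    simp only [h1]
    rw [← zero_div (1 - M.γ)]
    refine Tendsto.div_const ?_ _
    rw [← Finset.sum_const_zero (s := (Finset.univ : Finset M.AugSpace))]
    refine tendsto_finsetSum _ fun x _ => ?_
    rcases (M.occupancy_nonneg π₀ x).eq_or_lt with h0 | h0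
    · simp only [← h0, zero_mul]
      exact tendsto_const_nhds
    rw [← mul_zero (M.occupancy π₀ x)]
    refine Tendsto.const_mul _ ?_
    rw [← Finset.sum_const_zero (s := (Finset.univ : Finset A))]
    refine tendsto_finsetSum _ fun a _ => ?_
    have h2 : Tendsto (fun i => (π₀ x a).toReal - (π i x a).toReal) l (𝓝 0) := by
      simpa using (h x h0 a).const_sub (π₀ x a).toReal
    exact h2.zero_mul_isBoundedUnder_le
      (isBoundedUnder_of ⟨_, fun i => M.abs_advantage_le hB (π i) x a⟩)
  simpa using key.const_sub (M.value r π₀)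

theorem value_congr (r : M.AugSpace → A → ℝ) {π π₀ : M.Policy}
    (h : ∀ x, 0 < M.occupancy π₀ x → π x = π₀ x) : M.value r π = M.value r π₀ := by
  refine tendsto_nhds_unique (tendsto_const_nhds (f := (⊤ : Filter Unit)))
    (M.tendsto_value r (π := fun _ : Unit => π) fun x hx a => ?_)
  rw [h x hx]
  exact tendsto_const_nhds

theorem tendsto_occupancy {ι : Type*} {l : Filter ι} {π : ι → M.Policy} {π₀ : M.Policy}
    (h : ∀ x a, Tendsto (fun i => (π i x a).toReal) l (𝓝 (π₀ x a).toReal)) (x : M.AugSpace) :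
    Tendsto (fun i => M.occupancy (π i) x) l (𝓝 (M.occupancy π₀ x)) := by
  classical
  have hγ : 1 - M.γ ≠ 0 := (sub_pos.2 M.γ_lt_one).ne'
  have h1 : ∀ π, M.occupancy π x = M.value (fun y _ => if y = x then 1 else 0) π * (1 - M.γ) :=
    fun π => by
      rw [value, div_mul_cancel₀ _ hγ, Finset.sum_eq_single x]
      · simp [sum_toReal]
      · intro y _ hy; simp [hy]
      · simp
  simp only [h1]
  exact (M.tendsto_value _ fun x _ a => h x a).mul_const _

theorem value_linear {ι : Type*} [Fintype ι] (k : ℝ) (r : M.AugSpace → A → ℝ) (c : ι → ℝ)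
    (q : ι → M.AugSpace → A → ℝ) (π : M.Policy) :
    M.value (fun x a => k * r x a - ∑ i, c i * q i x a) π =
      k * M.value r π - ∑ i, c i * M.value (q i) π := by
  simp only [value, ← mul_div_assoc, ← Finset.sum_div, ← sub_div]
  congr 1
  simp only [mul_sub, Finset.sum_sub_distrib, Finset.mul_sum]
  congr 1
  · exact Finset.sum_congr rfl fun x _ => Finset.sum_congr rfl fun a _ => by ring
  · symm
    rw [Finset.sum_comm]
    refine Finset.sum_congr rfl fun x _ => ?_
    rw [Finset.sum_comm]
    exact Finset.sum_congr rfl fun a _ => Finset.sum_congr rfl fun i _ => by ring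

end CMDP
end
end RiskRL

namespace RiskRL
noncomputable section
namespace CMDP

set_option linter.unusedSectionVars false

variable {S A : Type*} {N : ℕ} (M : CMDP S A N) [Fintype A] [Nonempty A]

theorem sum_exp_pos (f : A → ℝ) : 0 < ∑ a, Real.exp (f a) :=
  Finset.sum_pos (fun _ _ => Real.exp_pos _) Finset.univ_nonempty

theorem softmax_toReal (θ : M.Param) (x : M.AugSpace) (a : A) :
    (M.softmax θ x a).toReal = Real.exp (θ (x, a)) / ∑ a', Real.exp (θ (x, a')) := by
  have := sum_exp_pos fun a' => θ (x, a')
  rw [softmax, PMF.ofFintype_apply, ENNReal.toReal_ofReal (by positivity)]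

theorem softmax_pos (θ : M.Param) (x : M.AugSpace) (a : A) : 0 < (M.softmax θ x a).toReal := by
  rw [softmax_toReal]
  exact div_pos (Real.exp_pos _) (sum_exp_pos _)

theorem log_softmax (θ : M.Param) (x : M.AugSpace) (a : A) :
    Real.log (M.softmax θ x a).toReal = θ (x, a) - Real.log (∑ a', Real.exp (θ (x, a'))) := by
  rw [softmax_toReal, Real.log_div (Real.exp_pos _).ne' (sum_exp_pos _).ne', Real.log_exp]

variable [Fintype M.AugSpace]

theorem gradient_apply {f : M.Param → ℝ} {f' : M.Param →L[ℝ] ℝ} {θ : M.Param}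
    (h : HasFDerivAt f f' θ) [DecidableEq (M.AugSpace × A)] (p : M.AugSpace × A) :
    gradient f θ p = f' (EuclideanSpace.single p 1) := by
  have h1 : inner ℝ (gradient f θ) (EuclideanSpace.single p 1) =
      f' (EuclideanSpace.single p 1) := by
    rw [inner_gradient_left, h.fderiv]
  rw [← h1, real_inner_comm, EuclideanSpace.inner_single_left]
  simp

/-- The differential of `θ ↦ log π_θ(a|x)`. -/
def scoreForm (θ : M.Param) (x : M.AugSpace) (a : A) : M.Param →L[ℝ] ℝ :=
  EuclideanSpace.proj (x, a) - ∑ b, (M.softmax θ x b).toReal • EuclideanSpace.proj (x, b)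

theorem scoreForm_apply (θ : M.Param) (x : M.AugSpace) (a : A) (w : M.Param) :
    M.scoreForm θ x a w = w (x, a) - ∑ b, (M.softmax θ x b).toReal * w (x, b) := by
  simp [scoreForm]

theorem hasFDerivAt_log_softmax (θ : M.Param) (x : M.AugSpace) (a : A) :
    HasFDerivAt (fun θ' : M.Param => Real.log (M.softmax θ' x a).toReal)
      (M.scoreForm θ x a) θ := by
  simp only [log_softmax]
  have hp : ∀ b : A, HasFDerivAt (fun θ' : M.Param => θ' (x, b))
      (EuclideanSpace.proj (x, b) : M.Param →L[ℝ] ℝ) θ := fun b =>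
    (EuclideanSpace.proj (𝕜 := ℝ) (x, b) : M.Param →L[ℝ] ℝ).hasFDerivAt
  have h := (hp a).sub ((HasFDerivAt.fun_sum (u := Finset.univ) fun b _ => (hp b).exp).log
    (sum_exp_pos fun b => θ (x, b)).ne')
  refine h.congr_fderiv ?_
  rw [scoreForm, Finset.smul_sum]
  congr 1
  refine Finset.sum_congr rfl fun b _ => ?_
  rw [smul_smul, softmax_toReal]
  congr 1
  ring

theorem hasFDerivAt_softmax (θ : M.Param) (x : M.AugSpace) (a : A) :
    HasFDerivAt (fun θ' : M.Param => (M.softmax θ' x a).toReal)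
      ((M.softmax θ x a).toReal • M.scoreForm θ x a) θ := by
  have h := (M.hasFDerivAt_log_softmax θ x a).exp
  simp only [Real.exp_log (M.softmax_pos _ x a)] at h
  exact h

theorem hasFDerivAt_mul_of_eq_zero {E : Type*} [NormedAddCommGroup E] [NormedSpace ℝ E]
    {f h : E → ℝ} {h' : E →L[ℝ] ℝ} {x : E} (hf : ContinuousAt f x) (hh : HasFDerivAt h h' x)
    (h0 : h x = 0) : HasFDerivAt (fun y => f y * h y) (f x • h') x := by
  have h1 : HasFDerivAt (fun y => (f y - f x) * h y) (0 : E →L[ℝ] ℝ) x := by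
    rw [hasFDerivAt_iff_isLittleO]
    simp only [h0, mul_zero, sub_zero, zero_apply]
    have ho : (fun y => f y - f x) =o[𝓝 x] (fun _ => (1 : ℝ)) := by
      rw [Asymptotics.isLittleO_one_iff]
      simpa using hf.tendsto.sub_const (f x)
    have hO : h =O[𝓝 x] fun y => y - x := by simpa [h0] using hh.isBigO_sub
    simpa using ho.mul_isBigO hO.norm_right
  have h2 := h1.add (hh.const_smul (f x))
  rw [zero_add] at h2
  refine h2.congr_of_eventuallyEq (Eventually.of_forall fun y => ?_)
  simp only [Pi.add_apply, Pi.smul_apply, smul_eq_mul]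
  ring

/-- The policy gradient theorem. -/
theorem hasFDerivAt_value (r : M.AugSpace → A → ℝ) (θ : M.Param) :
    HasFDerivAt (fun θ' : M.Param => M.value r (M.softmax θ'))
      (∑ x, ∑ a, (M.occupancy (M.softmax θ) x * ((M.softmax θ x a).toReal *
        (M.advantage r (M.softmax θ) x a / (1 - M.γ)))) •
          (EuclideanSpace.proj (x, a) : M.Param →L[ℝ] ℝ)) θ := by
  have h1 : ∀ x, HasFDerivAt (fun θ' : M.Param => M.occupancy (M.softmax θ') x *
      ∑ a, (M.softmax θ' x a).toReal * M.advantage r (M.softmax θ) x a)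
      (M.occupancy (M.softmax θ) x • ∑ a, M.advantage r (M.softmax θ) x a •
        ((M.softmax θ x a).toReal • M.scoreForm θ x a)) θ := fun x => by
    refine hasFDerivAt_mul_of_eq_zero ?_ ?_ (M.sum_mul_advantage r (M.softmax θ) x)
    · exact M.tendsto_occupancy (fun y b => (M.hasFDerivAt_softmax θ y b).continuousAt) x
    · exact HasFDerivAt.fun_sum fun a _ => (M.hasFDerivAt_softmax θ x a).mul_const _
  have h2 := ((HasFDerivAt.fun_sum (u := Finset.univ) fun x _ => h1 x).const_smul
    (1 - M.γ)⁻¹).add_const (M.value r (M.softmax θ))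
  refine (h2.congr_of_eventuallyEq (Eventually.of_forall fun θ' => ?_)).congr_fderiv ?_
  · have := M.value_sub_value r (M.softmax θ) (M.softmax θ')
    rw [sub_eq_iff_eq_add] at this
    rw [this, div_eq_inv_mul]
    rfl
  · ext w
    simp only [smul_apply, sum_apply, scoreForm_apply,
      smul_eq_mul, PiLp.proj_apply, Finset.mul_sum]
    refine Finset.sum_congr rfl fun x _ => ?_
    have h3 := M.sum_mul_advantage r (M.softmax θ) x
    have h4 : ∑ a, (1 - M.γ)⁻¹ * (M.occupancy (M.softmax θ) x *
        (M.advantage r (M.softmax θ) x a * ((M.softmax θ x a).toReal *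
          ∑ b, (M.softmax θ x b).toReal * w (x, b)))) = 0 := by
      rw [← mul_zero ((1 - M.γ)⁻¹ * M.occupancy (M.softmax θ) x *
        ∑ b, (M.softmax θ x b).toReal * w (x, b)), ← h3, Finset.mul_sum]
      exact Finset.sum_congr rfl fun a _ => by ring
    rw [← sub_eq_zero, ← Finset.sum_sub_distrib, ← neg_eq_zero, ← h4, ← Finset.sum_neg_distrib]
    refine Finset.sum_congr rfl fun a _ => ?_
    rw [div_eq_mul_inv]
    ring

theorem gradient_value_apply (r : M.AugSpace → A → ℝ) (θ : M.Param) (x : M.AugSpace) (a : A) :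
    gradient (fun θ' : M.Param => M.value r (M.softmax θ')) θ (x, a) =
      M.occupancy (M.softmax θ) x * ((M.softmax θ x a).toReal *
        (M.advantage r (M.softmax θ) x a / (1 - M.γ))) := by
  classical
  rw [gradient_apply M (M.hasFDerivAt_value r θ)]
  simp only [smul_apply, sum_apply,
      smul_eq_mul, PiLp.proj_apply, PiLp.single_apply, Prod.mk.injEq]
  rw [Finset.sum_eq_single x, Finset.sum_eq_single a]
  · simp
  · intro b _ hb; simp [hb]
  · simp
  · intro y _ hy; simp [hy]
  · simp

theorem score_apply [DecidableEq (M.AugSpace × A)] (θ : M.Param) (x : M.AugSpace) (a : A)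
    (p : M.AugSpace × A) : M.score θ x a p = M.scoreForm θ x a (EuclideanSpace.single p 1) :=
  M.gradient_apply (M.hasFDerivAt_log_softmax θ x a) p

theorem sum_score_mul (θ : M.Param) (x : M.AugSpace) (a : A) (w : M.Param) :
    ∑ p, M.score θ x a p * w p = M.scoreForm θ x a w := by
  classical
  have h : M.score θ x a = gradient (fun θ' : M.Param => Real.log (M.softmax θ' x a).toReal) θ := rfl
  have h1 : inner ℝ (M.score θ x a) w = M.scoreForm θ x a w := by
    rw [h, inner_gradient_left, (M.hasFDerivAt_log_softmax θ x a).fderiv]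
  rw [← h1, PiLp.inner_apply]
  exact Finset.sum_congr rfl fun p _ => by simp [mul_comm]

theorem fisher_mulVec (θ w : M.Param) (y : M.AugSpace) (b : A) :
    (M.fisher θ).mulVec w (y, b) =
      M.occupancy (M.softmax θ) y * ((M.softmax θ y b).toReal * M.scoreForm θ y b w) := by
  classical
  have h1 : (M.fisher θ).mulVec w (y, b) = ∑ x, ∑ a,
      M.occupancy (M.softmax θ) x * (M.softmax θ x a).toReal * M.score θ x a (y, b) *
        M.scoreForm θ x a w := by
    simp only [Matrix.mulVec, dotProduct, fisher, Matrix.of_apply, Finset.sum_mul, ← sum_score_mul,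
      Finset.mul_sum]
    rw [Finset.sum_comm]
    refine Finset.sum_congr rfl fun x _ => ?_
    rw [Finset.sum_comm]
    exact Finset.sum_congr rfl fun a _ => Finset.sum_congr rfl fun p _ => by ring
  have h2 : ∀ x, ∑ a, (M.softmax θ x a).toReal * M.scoreForm θ x a w = 0 := fun x => by
    simp only [scoreForm_apply, mul_sub, Finset.sum_sub_distrib]
    rw [← Finset.sum_mul, sum_toReal, one_mul, sub_self]
  have h3 : ∀ x a, M.score θ x a (y, b) = if x = y then ((if a = b then 1 else 0) -
      (M.softmax θ y b).toReal) else 0 := fun x a => by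
    rw [score_apply, scoreForm_apply]
    by_cases hx : x = y
    · subst hx
      simp [PiLp.single_apply]
    · simp [hx]
  rw [h1, Finset.sum_eq_single y]
  · simp only [h3, if_true, mul_sub, sub_mul, Finset.sum_sub_distrib]
    have h4 : ∑ a, M.occupancy (M.softmax θ) y * (M.softmax θ y a).toReal *
        (M.softmax θ y b).toReal * M.scoreForm θ y a w = 0 := by
      rw [← mul_zero (M.occupancy (M.softmax θ) y * (M.softmax θ y b).toReal), ← h2 y,
        Finset.mul_sum]
      exact Finset.sum_congr rfl fun a _ => by ring
    rw [h4, sub_zero]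
    simp [mul_assoc]
  · intro x _ hx
    simp [h3, hx]
  · simp

theorem isMoorePenrose_pinv_fisher (θ : M.Param) :
    IsMoorePenrose (M.fisher θ) (pinv (M.fisher θ)) := by
  classical
  have h : (M.fisher θ).IsHermitian := by
    ext p q
    simp only [fisher, Matrix.conjTranspose_apply, Matrix.of_apply, star_trivial]
    exact Finset.sum_congr rfl fun x _ => Finset.sum_congr rfl fun a _ => by ring
  have h2 := exists_isMoorePenrose _ h
  rw [pinv, dif_pos h2]
  exact h2.choose_spec

/-- The natural policy gradient is the advantage function up to a state-dependent constant. -/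
theorem exists_natural_gradient_eq [DecidableEq (M.AugSpace × A)] (r : M.AugSpace → A → ℝ) (θ : M.Param) :
    ∃ c : M.AugSpace → ℝ, ∀ x a, Matrix.toEuclideanLin (pinv (M.fisher θ))
      (gradient (fun θ' : M.Param => M.value r (M.softmax θ')) θ) (x, a) =
        M.advantage r (M.softmax θ) x a / (1 - M.γ) + c x := by
  set F := M.fisher θ with hF
  set G := gradient (fun θ' : M.Param => M.value r (M.softmax θ')) θ with hG
  set u : M.Param := WithLp.toLp 2 fun p => M.advantage r (M.softmax θ) p.1 p.2 / (1 - M.γ) with hu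
  set w := Matrix.toEuclideanLin (pinv F) G with hw
  have hu' : ∀ x a, M.scoreForm θ x a u = u (x, a) := fun x a => by
    rw [scoreForm_apply, sub_eq_self]
    simp only [hu, mul_div_assoc', ← Finset.sum_div, sum_mul_advantage, zero_div]
  have h1 : F.mulVec u = G := by
    ext ⟨x, a⟩
    rw [fisher_mulVec, hu', gradient_value_apply]
  have h2 : F.mulVec w = F.mulVec u := by
    have h3 : (w : M.AugSpace × A → ℝ) = (pinv F).mulVec G := rfl
    rw [h3, ← h1, Matrix.mulVec_mulVec, Matrix.mulVec_mulVec, (M.isMoorePenrose_pinv_fisher θ).mul_mul_self]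
  refine ⟨fun x => ∑ b, (M.softmax θ x b).toReal * w (x, b), fun x a => ?_⟩
  have h4 := congrFun h2 (x, a)
  rw [fisher_mulVec, fisher_mulVec] at h4
  have h5 := mul_left_cancel₀ (M.softmax_pos θ x a).ne'
    (mul_left_cancel₀ (M.occupancy_pos _ (M.softmax_pos θ) x).ne' h4)
  rw [hu', scoreForm_apply, sub_eq_iff_eq_add] at h5
  exact h5

end CMDP
end
end RiskRL

namespace RiskRL
noncomputable section
namespace CMDP

set_option linter.unusedSectionVars false

variable {S A : Type*} {N : ℕ} (M : CMDP S A N) [Fintype A] [Nonempty A] [Fintype M.AugSpace]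

theorem abs_value_le {r : M.AugSpace → A → ℝ} {B : ℝ} (hB : ∀ x a, |r x a| ≤ B) (π : M.Policy) :
    |M.value r π| ≤ B / (1 - M.γ) := by
  have hγ : 0 < 1 - M.γ := sub_pos.2 M.γ_lt_one
  rw [value, abs_div, abs_of_pos hγ]
  refine div_le_div_of_nonneg_right ?_ hγ.le
  exact abs_sum_mul_le (M.occupancy_nonneg π) (M.sum_occupancy π) fun x =>
    abs_sum_mul_le (fun _ => ENNReal.toReal_nonneg) (sum_toReal _) (hB x)

/-- Cross entropy of `π_θ` relative to `π`, averaged over the occupancy measure of `π`. -/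
def potential (π : M.Policy) (θ : M.Param) : ℝ :=
  -∑ x, M.occupancy π x * ∑ a, (π x a).toReal * Real.log (M.softmax θ x a).toReal

theorem softmax_le_one (θ : M.Param) (x : M.AugSpace) (a : A) : (M.softmax θ x a).toReal ≤ 1 := by
  rw [← ENNReal.toReal_one]
  exact ENNReal.toReal_mono ENNReal.one_ne_top (PMF.coe_le_one _ _)

theorem potential_nonneg (π : M.Policy) (θ : M.Param) : 0 ≤ M.potential π θ := by
  refine neg_nonneg.2 (Finset.sum_nonpos fun x _ => ?_)
  refine mul_nonpos_of_nonneg_of_nonpos (M.occupancy_nonneg π x) (Finset.sum_nonpos fun a _ => ?_)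
  exact mul_nonpos_of_nonneg_of_nonpos ENNReal.toReal_nonneg
    (Real.log_nonpos ENNReal.toReal_nonneg (M.softmax_le_one θ x a))

theorem log_sum_mul_exp_le {p y : A → ℝ} {Y : ℝ} (hp : ∀ a, 0 < p a) (hp1 : ∑ a, p a = 1)
    (h0 : ∑ a, p a * y a = 0) (hy : ∀ a, |y a| ≤ Y) (hY : Y ≤ 1) :
    Real.log (∑ a, p a * Real.exp (y a)) ≤ Y ^ 2 := by
  have hpos : 0 < ∑ a, p a * Real.exp (y a) :=
    Finset.sum_pos (fun a _ => mul_pos (hp a) (Real.exp_pos _)) Finset.univ_nonempty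
  have h1 : ∑ a, p a * Real.exp (y a) ≤ ∑ a, (p a + p a * y a + p a * Y ^ 2) := by
    refine Finset.sum_le_sum fun a _ => ?_
    have h2 := (abs_le.1 (Real.abs_exp_sub_one_sub_id_le ((hy a).trans hY))).2
    have h3 : y a ^ 2 ≤ Y ^ 2 := by
      rw [← sq_abs (y a)]
      exact pow_le_pow_left₀ (abs_nonneg _) (hy a) 2
    nlinarith [hp a]
  rw [Finset.sum_add_distrib, Finset.sum_add_distrib, hp1, h0, ← Finset.sum_mul, hp1] at h1
  have := Real.log_le_sub_one_of_pos hpos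
  linarith

theorem log_softmax_add {θ θ' : M.Param} {x : M.AugSpace} {y : A → ℝ} {c : ℝ}
    (h : ∀ a, θ' (x, a) = θ (x, a) + y a + c) (a : A) :
    Real.log (M.softmax θ' x a).toReal = Real.log (M.softmax θ x a).toReal + y a -
      Real.log (∑ b, (M.softmax θ x b).toReal * Real.exp (y b)) := by
  have hZ := sum_exp_pos fun b => θ (x, b)
  have h1 : ∑ b, (M.softmax θ x b).toReal * Real.exp (y b) =
      (∑ b, Real.exp (θ (x, b) + y b)) / ∑ b, Real.exp (θ (x, b)) := by
    rw [Finset.sum_div]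
    refine Finset.sum_congr rfl fun b _ => ?_
    rw [softmax_toReal, Real.exp_add]
    ring
  have h2 : ∑ b, Real.exp (θ' (x, b)) = (∑ b, Real.exp (θ (x, b) + y b)) * Real.exp c := by
    rw [Finset.sum_mul]
    exact Finset.sum_congr rfl fun b _ => by rw [h, Real.exp_add _ c]
  rw [log_softmax, log_softmax, h1, h2, Real.log_mul (sum_exp_pos _).ne' (Real.exp_pos c).ne',
    Real.log_div (sum_exp_pos _).ne' hZ.ne', Real.log_exp, h]
  ring

/-- A natural policy gradient step decreases the potential of every policy of larger value. -/
theorem potential_step_le [DecidableEq (M.AugSpace × A)] {r : M.AugSpace → A → ℝ} {B α : ℝ}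
    (hB : ∀ x a, |r x a| ≤ B) (hα : 0 ≤ α)
    (hαB : α * (2 * (B / (1 - M.γ)) / (1 - M.γ)) ≤ 1) (π : M.Policy) (θ : M.Param) :
    M.potential π (θ + α • Matrix.toEuclideanLin (pinv (M.fisher θ))
      (gradient (fun θ' : M.Param => M.value r (M.softmax θ')) θ)) ≤
      M.potential π θ - α * (M.value r π - M.value r (M.softmax θ)) +
        (α * (2 * (B / (1 - M.γ)) / (1 - M.γ))) ^ 2 := by
  have hγ : 0 < 1 - M.γ := sub_pos.2 M.γ_lt_one
  obtain ⟨c, hc⟩ := M.exists_natural_gradient_eq r θ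
  set w := Matrix.toEuclideanLin (pinv (M.fisher θ))
    (gradient (fun θ' : M.Param => M.value r (M.softmax θ')) θ) with hw
  set U := 2 * (B / (1 - M.γ)) / (1 - M.γ) with hU
  set u : M.AugSpace → A → ℝ := fun x a => α * (M.advantage r (M.softmax θ) x a / (1 - M.γ)) with hu
  have hu1 : ∀ x a, |u x a| ≤ α * U := fun x a => by
    rw [hu, abs_mul, abs_of_nonneg hα, abs_div, abs_of_pos hγ]
    exact mul_le_mul_of_nonneg_left
      (div_le_div_of_nonneg_right (M.abs_advantage_le hB _ x a) hγ.le) hα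
  have hu2 : ∀ x, ∑ a, (M.softmax θ x a).toReal * u x a = 0 := fun x => by
    rw [← mul_zero (α / (1 - M.γ)), ← M.sum_mul_advantage r (M.softmax θ) x, Finset.mul_sum]
    exact Finset.sum_congr rfl fun a _ => by simp only [hu]; ring
  have h1 : ∀ x a, (θ + α • w) (x, a) = θ (x, a) + u x a + α * c x := fun x a => by
    simp only [PiLp.add_apply, PiLp.smul_apply, smul_eq_mul, hc, hu]
    ring
  have h2 : ∀ x a, Real.log (M.softmax θ x a).toReal + u x a - (α * U) ^ 2 ≤
      Real.log (M.softmax (θ + α • w) x a).toReal := fun x a => by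
    rw [M.log_softmax_add (h1 x) a]
    exact sub_le_sub_left (log_sum_mul_exp_le (M.softmax_pos θ x) (sum_toReal _) (hu2 x) (hu1 x)
      hαB) _
  have h3 : α * (M.value r π - M.value r (M.softmax θ)) =
      ∑ x, M.occupancy π x * ∑ a, (π x a).toReal * u x a := by
    rw [value_sub_value, Finset.sum_div, Finset.mul_sum]
    refine Finset.sum_congr rfl fun x _ => ?_
    rw [← mul_div_assoc', Finset.sum_div, mul_left_comm, Finset.mul_sum]
    exact congrArg _ (Finset.sum_congr rfl fun a _ => by simp only [hu]; ring)
  have h4 : ∑ x, M.occupancy π x * ∑ a, (π x a).toReal *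
      (Real.log (M.softmax θ x a).toReal + u x a - (α * U) ^ 2) =
      -M.potential π θ + α * (M.value r π - M.value r (M.softmax θ)) - (α * U) ^ 2 := by
    rw [h3, potential, neg_neg]
    simp only [mul_sub, mul_add, Finset.sum_sub_distrib, Finset.sum_add_distrib]
    rw [← Finset.sum_congr rfl fun x _ => congrArg (M.occupancy π x * ·)
      (Finset.sum_mul Finset.univ (fun a => (π x a).toReal) ((α * U) ^ 2))]
    simp only [sum_toReal, one_mul]
    rw [← Finset.sum_mul, sum_occupancy, one_mul]
  have h5 : ∑ x, M.occupancy π x * ∑ a, (π x a).toReal *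
      (Real.log (M.softmax θ x a).toReal + u x a - (α * U) ^ 2) ≤
      -M.potential π (θ + α • w) := by
    rw [potential, neg_neg]
    refine Finset.sum_le_sum fun x _ => mul_le_mul_of_nonneg_left ?_ (M.occupancy_nonneg π x)
    exact Finset.sum_le_sum fun a _ => mul_le_mul_of_nonneg_left (h2 x a) ENNReal.toReal_nonneg
  linarith

/-- The reward whose value is, up to a constant, `k J_R - ∑ i, c i J_{C_i}`. -/
def combinedReward (g : Fin N → ℝ → ℝ) (k : ℝ) (c : Fin N → ℝ) (x : M.AugSpace) (a : A) : ℝ :=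
  k * M.rewardR x a - ∑ i, c i * M.rewardC g i x a

theorem value_combinedReward (g : Fin N → ℝ → ℝ) (k : ℝ) (c : Fin N → ℝ) (π : M.Policy) :
    M.value (M.combinedReward g k c) π =
      k * M.value M.rewardR π - ∑ i, c i * M.value (M.rewardC g i) π :=
  M.value_linear k M.rewardR c (M.rewardC g) π

theorem gradient_objective {σ g : Fin N → ℝ → ℝ} (hg : ∀ i, ConvexOn ℝ Set.univ (g i))
    (k : ℝ) (c : Fin N → ℝ) (θ : M.Param) :
    gradient (fun θ' : M.Param =>
      k * M.JR (M.softmax θ') - ∑ i, c i * M.JC σ g i (M.softmax θ')) θ =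
      gradient (fun θ' : M.Param => M.value (M.combinedReward g k c) (M.softmax θ')) θ := by
  have h : (fun θ' : M.Param =>
      k * M.JR (M.softmax θ') - ∑ i, c i * M.JC σ g i (M.softmax θ')) = fun θ' =>
      M.value (M.combinedReward g k c) (M.softmax θ') -
        ∑ i, c i * (g i 0 + ∫ u in (0 : ℝ)..1, conj (g i) (σ i u)) := by
    funext θ'
    rw [value_combinedReward, JR_eq_value]
    simp only [M.JC_eq_value σ g _ (hg _), mul_add, Finset.sum_add_distrib]
    ring
  rw [h, gradient, gradient, fderiv_sub_const]

open Classical in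
/-- Progress towards `π` made by one update at `θ`, per unit of step size. -/
def gap (σ g : Fin N → ℝ → ℝ) (d : Fin N → ℝ) (lam : Fin N → ℝ) (π : M.Policy)
    (θ : M.Param) : ℝ :=
  if M.IsFeasible σ g d (M.softmax θ) then M.JR π - M.JR (M.softmax θ)
  else ∑ i, lam i * (M.JC σ g i (M.softmax θ) - M.JC σ g i π)

theorem JC_sub_JC {σ g : Fin N → ℝ → ℝ} (hg : ∀ i, ConvexOn ℝ Set.univ (g i)) (i : Fin N)
    (π π' : M.Policy) : M.JC σ g i π - M.JC σ g i π' =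
      M.value (M.rewardC g i) π - M.value (M.rewardC g i) π' := by
  rw [M.JC_eq_value σ g i (hg i), M.JC_eq_value σ g i (hg i)]
  ring

/-- One update changes the potential of a policy by at most minus the gap, up to a term that is
quadratic in the step size. -/
theorem exists_potential_update_le {σ g : Fin N → ℝ → ℝ} (hg : ∀ i, ConvexOn ℝ Set.univ (g i))
    (d : Fin N → ℝ) (L : ℝ) : ∃ δ > 0, ∃ K : ℝ, ∀ α, 0 ≤ α → α ≤ δ → ∀ (lam : Fin N → ℝ) (ν : ℝ),
      (∀ i, lam i ∈ Set.Icc 0 L) → ν ∈ Set.Icc 0 L → ∀ (π : M.Policy) (θ : M.Param),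
      M.potential π (M.update σ g d α lam ν θ) ≤
        M.potential π θ - α * M.gap σ g d lam π θ + K * α ^ 2 := by
  classical
  have hγ : 0 < 1 - M.γ := sub_pos.2 M.γ_lt_one
  obtain ⟨D, hD0, hDR, hDC⟩ : ∃ D : ℝ, 0 ≤ D ∧ (∀ x a, |M.rewardR x a| ≤ D) ∧
      ∀ i x a, |M.rewardC g i x a| ≤ D := by
    obtain ⟨D₁, h₁⟩ := M.exists_abs_reward_le M.rewardR
    choose D₂ h₂ using fun i => M.exists_abs_reward_le (M.rewardC g i)
    refine ⟨|D₁| + ∑ i, |D₂ i|, by positivity, fun x a => ?_, fun i x a => ?_⟩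
    · have : 0 ≤ ∑ i, |D₂ i| := by positivity
      linarith [h₁ x a, le_abs_self D₁]
    · have := Finset.single_le_sum (f := fun i => |D₂ i|) (fun _ _ => abs_nonneg _)
        (Finset.mem_univ i)
      linarith [h₂ i x a, le_abs_self (D₂ i), abs_nonneg D₁]
  set L' := |L| with hL'
  have hL0 : 0 ≤ L' := abs_nonneg L
  set B := (1 + L') * D + ∑ _i : Fin N, L' * D with hB
  have hcomb : ∀ (k : ℝ) (c : Fin N → ℝ), |k| ≤ 1 + L' → (∀ i, |c i| ≤ L') → ∀ x a,
      |M.combinedReward g k c x a| ≤ B := by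
    intro k c hk hc x a
    refine (abs_sub _ _).trans (add_le_add ?_ ((Finset.abs_sum_le_sum_abs _ _).trans
      (Finset.sum_le_sum fun i _ => ?_))) <;> rw [abs_mul]
    · exact mul_le_mul hk (hDR x a) (abs_nonneg _) (by positivity)
    · exact mul_le_mul (hc i) (hDC i x a) (abs_nonneg _) hL0
  have hB0 : 0 ≤ B := by positivity
  set U := 2 * (B / (1 - M.γ)) / (1 - M.γ) with hU
  have hU0 : 0 ≤ U := by positivity
  set E := 2 * (D / (1 - M.γ)) with hE
  have hE0 : 0 ≤ E := by positivity
  have hdiff : ∀ {r : M.AugSpace → A → ℝ}, (∀ x a, |r x a| ≤ D) → ∀ π π',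
      |M.value r π - M.value r π'| ≤ E := fun hr π π' => by
    have := (abs_sub (M.value _ π) (M.value _ π')).trans
      (add_le_add (M.abs_value_le hr π) (M.abs_value_le hr π'))
    rw [hE]; linarith
  refine ⟨min 1 (1 / (U + 1)), by positivity, U ^ 2 + (L' * E + ∑ _i : Fin N, L' * E), ?_⟩
  intro α hα hαδ lam ν hlam hν π θ
  have hα1 : α ≤ 1 := hαδ.trans (min_le_left _ _)
  have hαU : α * U ≤ 1 := by
    have h := hαδ.trans (min_le_right _ _)
    rw [le_div_iff₀ (by positivity)] at h
    linarith
  have hlam' : ∀ i, |lam i| ≤ L' := fun i => by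
    rw [abs_of_nonneg (hlam i).1]; exact (hlam i).2.trans (le_abs_self L)
  have hν' : |ν| ≤ L' := by
    rw [abs_of_nonneg hν.1]; exact hν.2.trans (le_abs_self L)
  have hαabs : |α| ≤ 1 := by rwa [abs_of_nonneg hα]
  unfold update gap
  split_ifs with hf
  · have h1 : ∀ θ' : M.Param, M.JR (M.softmax θ') - α * ∑ i, lam i * M.JC σ g i (M.softmax θ') =
        1 * M.JR (M.softmax θ') - ∑ i, (α * lam i) * M.JC σ g i (M.softmax θ') := fun θ' => by
      rw [one_mul, Finset.mul_sum]
      simp only [mul_assoc]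
    simp only [h1]
    rw [M.gradient_objective hg]
    have h2 := M.potential_step_le (α := α) (hcomb 1 (fun i => α * lam i)
      (by rw [abs_one]; linarith) fun i => by
        rw [abs_mul]; exact (mul_le_mul hαabs (hlam' i) (abs_nonneg _) zero_le_one).trans_eq
          (one_mul _)) hα hαU π θ
    refine h2.trans ?_
    rw [value_combinedReward, value_combinedReward, JR_eq_value, JR_eq_value]
    have h3 : |∑ i, lam i * (M.value (M.rewardC g i) π - M.value (M.rewardC g i) (M.softmax θ))| ≤
        ∑ _i : Fin N, L' * E := by
      refine (Finset.abs_sum_le_sum_abs _ _).trans (Finset.sum_le_sum fun i _ => ?_)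
      rw [abs_mul]
      exact mul_le_mul (hlam' i) (hdiff (hDC i) _ _) (abs_nonneg _) hL0
    have h4 : ∑ i, α * lam i * M.value (M.rewardC g i) π -
        ∑ i, α * lam i * M.value (M.rewardC g i) (M.softmax θ) =
        α * ∑ i, lam i * (M.value (M.rewardC g i) π - M.value (M.rewardC g i) (M.softmax θ)) := by
      rw [Finset.mul_sum, ← Finset.sum_sub_distrib]
      exact Finset.sum_congr rfl fun i _ => by ring
    have h5 := mul_le_mul_of_nonneg_left ((le_abs_self _).trans h3) (sq_nonneg α)
    have h6 : 0 ≤ L' * E * α ^ 2 := by positivity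
    have h7 := congrArg (α * ·) h4
    nlinarith
  · rw [M.gradient_objective hg]
    have h2 := M.potential_step_le (α := α) (hcomb (α * ν) lam
      (by
        rw [abs_mul]
        exact (mul_le_mul hαabs hν' (abs_nonneg _) zero_le_one).trans (by linarith)) hlam') hα hαU π θ
    refine h2.trans ?_
    rw [value_combinedReward, value_combinedReward]
    simp only [M.JC_sub_JC hg]
    have h3 : |ν * (M.value M.rewardR π - M.value M.rewardR (M.softmax θ))| ≤ L' * E := by
      rw [abs_mul]
      exact mul_le_mul hν' (hdiff hDR _ _) (abs_nonneg _) hL0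
    have h4 : ∑ i, lam i * (M.value (M.rewardC g i) (M.softmax θ) - M.value (M.rewardC g i) π) =
        ∑ i, lam i * M.value (M.rewardC g i) (M.softmax θ) -
          ∑ i, lam i * M.value (M.rewardC g i) π := by
      rw [← Finset.sum_sub_distrib]
      exact Finset.sum_congr rfl fun i _ => by ring
    have h5 := mul_le_mul_of_nonneg_left ((neg_le_abs _).trans h3) (sq_nonneg α)
    have h6 : 0 ≤ (∑ _i : Fin N, L' * E) * α ^ 2 := by positivity
    rw [h4]
    nlinarith

end CMDP
end
end RiskRL

namespace RiskRL
noncomputable section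

theorem RobbinsMonro.tendsto_zero {α : ℕ → ℝ} (hα : RobbinsMonro α) : Tendsto α atTop (𝓝 0) := by
  have h := (Real.continuous_sqrt.tendsto 0).comp hα.sq_summable.tendsto_atTop_zero
  rw [Real.sqrt_zero] at h
  exact h.congr fun t => Real.sqrt_sq (hα.pos t).le

theorem RobbinsMonro.false_of_eventually_le_sub {α : ℕ → ℝ} (hα : RobbinsMonro α) {Φ : ℕ → ℝ}
    (h0 : ∀ t, 0 ≤ Φ t) {c K : ℝ} (hc : 0 < c)
    (h : ∀ᶠ t in atTop, Φ (t + 1) ≤ Φ t - α t * c + K * α t ^ 2) : False := by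
  obtain ⟨T, hT⟩ := eventually_atTop.1 h
  set Ψ : ℕ → ℝ := fun n => Φ n + c * ∑ t ∈ Finset.range n, α t -
    K * ∑ t ∈ Finset.range n, α t ^ 2 with hΨ
  have h1 : ∀ n ≥ T, Ψ n ≤ Ψ T := by
    intro n hn
    induction n, hn using Nat.le_induction with
    | base => exact le_rfl
    | succ n hn ih =>
      refine le_trans ?_ ih
      simp only [hΨ, Finset.sum_range_succ]
      have := hT n hn
      linarith
  obtain ⟨n, hn, hn'⟩ := ((hα.sum_eq_top.const_mul_atTop hc).eventually_gt_atTop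
    (Ψ T + |K| * ∑' t, α t ^ 2)).and (eventually_ge_atTop T) |>.exists
  have h2 := h1 n hn'
  have h3 : K * ∑ t ∈ Finset.range n, α t ^ 2 ≤ |K| * ∑' t, α t ^ 2 :=
    mul_le_mul (le_abs_self K) (hα.sq_summable.sum_le_tsum _ fun t _ => sq_nonneg _)
      (Finset.sum_nonneg fun t _ => sq_nonneg _) (abs_nonneg K)
  have h4 := h0 n
  simp only [hΨ] at h2 hn
  linarith

theorem RobbinsMonro.exists_tendsto {α : ℕ → ℝ} (hα : RobbinsMonro α) {Φ : ℕ → ℝ}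
    (h0 : ∀ t, 0 ≤ Φ t) {K : ℝ} (h : ∀ᶠ t in atTop, Φ (t + 1) ≤ Φ t + K * α t ^ 2) :
    ∃ l, Tendsto Φ atTop (𝓝 l) := by
  obtain ⟨T, hT⟩ := eventually_atTop.1 h
  set Ψ : ℕ → ℝ := fun n => Φ n - K * ∑ t ∈ Finset.range n, α t ^ 2 with hΨ
  have h1 : Antitone fun n => Ψ (n + T) := antitone_nat_of_succ_le fun n => by
    have := hT (n + T) (by omega)
    simp only [hΨ]
    rw [add_right_comm, Finset.sum_range_succ]
    linarith
  have h2 : BddBelow (Set.range fun n => Ψ (n + T)) := by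
    refine ⟨-(|K| * ∑' t, α t ^ 2), ?_⟩
    rintro _ ⟨n, rfl⟩
    have h3 : K * ∑ t ∈ Finset.range (n + T), α t ^ 2 ≤ |K| * ∑' t, α t ^ 2 :=
      mul_le_mul (le_abs_self K) (hα.sq_summable.sum_le_tsum _ fun t _ => sq_nonneg _)
        (Finset.sum_nonneg fun t _ => sq_nonneg _) (abs_nonneg K)
    have := h0 (n + T)
    simp only [hΨ]
    linarith
  have h3 := (tendsto_add_atTop_iff_nat T).1 (tendsto_atTop_ciInf h1 h2)
  have h4 := h3.add (hα.sq_summable.hasSum.tendsto_sum_nat.const_mul K)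
  exact ⟨_, h4.congr fun n => by simp only [hΨ]; ring⟩

theorem sq_sqrt_sub_sqrt_le {p q : ℝ} (hp : 0 ≤ p) (hq : 0 < q) :
    (√p - √q) ^ 2 ≤ p * Real.log p - p * Real.log q - p + q := by
  rcases hp.eq_or_lt with rfl | hp
  · simp [Real.sq_sqrt hq.le]
  have hsp := Real.sqrt_pos.2 hp
  have hsq := Real.sqrt_pos.2 hq
  have h1 := Real.log_le_sub_one_of_pos (div_pos hsq hsp)
  rw [Real.log_div hsq.ne' hsp.ne', Real.log_sqrt hp.le, Real.log_sqrt hq.le] at h1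
  have h2 : p * (√q / √p) = √p * √q := by
    nth_rewrite 1 [← Real.mul_self_sqrt hp.le]
    field_simp
  have h3 := mul_le_mul_of_nonneg_left h1 hp.le
  rw [mul_sub p (√q / √p), h2] at h3
  have h4 := Real.sq_sqrt hp.le
  have h5 := Real.sq_sqrt hq.le
  nlinarith

namespace CMDP

set_option linter.unusedSectionVars false

variable {S A : Type*} {N : ℕ} (M : CMDP S A N) [Fintype A] [Nonempty A] [Fintype M.AugSpace]

/-- Averaged entropy of a policy. -/
def entropy (π : M.Policy) : ℝ :=
  -∑ x, M.occupancy π x * ∑ a, (π x a).toReal * Real.log (π x a).toReal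

theorem sq_sqrt_sub_sqrt_le_potential (π : M.Policy) (θ : M.Param) (x : M.AugSpace) (a : A) :
    M.occupancy π x * (√(π x a).toReal - √(M.softmax θ x a).toReal) ^ 2 ≤
      M.potential π θ - M.entropy π := by
  have h1 : ∀ y, ∑ b, (√(π y b).toReal - √(M.softmax θ y b).toReal) ^ 2 ≤
      ∑ b, (π y b).toReal * Real.log (π y b).toReal -
        ∑ b, (π y b).toReal * Real.log (M.softmax θ y b).toReal := fun y => by
    refine (Finset.sum_le_sum fun b _ =>
      sq_sqrt_sub_sqrt_le ENNReal.toReal_nonneg (M.softmax_pos θ y b)).trans_eq ?_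
    rw [Finset.sum_add_distrib, Finset.sum_sub_distrib, Finset.sum_sub_distrib, sum_toReal,
      sum_toReal]
    ring
  calc _ ≤ M.occupancy π x * ∑ b, (√(π x b).toReal - √(M.softmax θ x b).toReal) ^ 2 :=
        mul_le_mul_of_nonneg_left (Finset.single_le_sum
          (f := fun b => (√(π x b).toReal - √(M.softmax θ x b).toReal) ^ 2)
          (fun _ _ => sq_nonneg _) (Finset.mem_univ a)) (M.occupancy_nonneg π x)
    _ ≤ ∑ y, M.occupancy π y * ∑ b, (√(π y b).toReal - √(M.softmax θ y b).toReal) ^ 2 :=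
        Finset.single_le_sum
          (f := fun y => M.occupancy π y * ∑ b, (√(π y b).toReal - √(M.softmax θ y b).toReal) ^ 2)
          (fun y _ => mul_nonneg (M.occupancy_nonneg π y) (Finset.sum_nonneg fun _ _ => sq_nonneg _))
          (Finset.mem_univ x)
    _ ≤ _ := by
        rw [potential, entropy, neg_sub_neg, ← Finset.sum_sub_distrib]
        refine Finset.sum_le_sum fun y _ => ?_
        rw [← mul_sub]
        exact mul_le_mul_of_nonneg_left (h1 y) (M.occupancy_nonneg π y)

theorem tendsto_potential {ι : Type*} {l : Filter ι} {π : M.Policy} {θ : ι → M.Param}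
    (h : ∀ x a, Tendsto (fun i => (M.softmax (θ i) x a).toReal) l (𝓝 (π x a).toReal)) :
    Tendsto (fun i => M.potential π (θ i)) l (𝓝 (M.entropy π)) := by
  refine (tendsto_finsetSum _ fun x _ => Tendsto.const_mul _ (tendsto_finsetSum _ fun a _ => ?_)).neg
  rcases (ENNReal.toReal_nonneg (a := π x a)).eq_or_lt with h0 | h0
  · simp only [← h0, zero_mul]
    exact tendsto_const_nhds
  · exact ((h x a).log h0.ne').const_mul _

/-- If the potential tends to its minimal value, the softmax policies converge on the visited
states. -/
theorem tendsto_softmax_of_tendsto_potential {ι : Type*} {l : Filter ι} {π : M.Policy}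
    {θ : ι → M.Param} (h : Tendsto (fun i => M.potential π (θ i)) l (𝓝 (M.entropy π)))
    (x : M.AugSpace) (hx : 0 < M.occupancy π x) (a : A) :
    Tendsto (fun i => (M.softmax (θ i) x a).toReal) l (𝓝 (π x a).toReal) := by
  have h1 : Tendsto (fun i => (M.potential π (θ i) - M.entropy π) / M.occupancy π x) l (𝓝 0) := by
    simpa using (h.sub_const (M.entropy π)).div_const (M.occupancy π x)
  have h2 : Tendsto (fun i => (√(π x a).toReal - √(M.softmax (θ i) x a).toReal) ^ 2) l (𝓝 0) := by
    refine squeeze_zero (fun i => sq_nonneg _) (fun i => ?_) h1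
    rw [le_div_iff₀ hx, mul_comm]
    exact M.sq_sqrt_sub_sqrt_le_potential π (θ i) x a
  have h3 : Tendsto (fun i => √(π x a).toReal - √(M.softmax (θ i) x a).toReal) l (𝓝 0) := by
    have h4 := (Real.continuous_sqrt.tendsto 0).comp h2
    rw [Real.sqrt_zero] at h4
    rw [tendsto_zero_iff_abs_tendsto_zero]
    exact h4.congr fun i => Real.sqrt_sq_eq_abs _
  have h4 : Tendsto (fun i => √(M.softmax (θ i) x a).toReal) l (𝓝 √(π x a).toReal) := by
    simpa using h3.const_sub √(π x a).toReal
  have h5 := h4.pow 2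
  simpa only [Real.sq_sqrt ENNReal.toReal_nonneg] using h5

/-- The set of policies is sequentially compact. -/
theorem exists_subseq_tendsto (π : ℕ → M.Policy) : ∃ π₀ : M.Policy, ∃ φ : ℕ → ℕ, StrictMono φ ∧
    ∀ x a, Tendsto (fun n => (π (φ n) x a).toReal) atTop (𝓝 (π₀ x a).toReal) := by
  have hK : IsCompact (Set.Icc (0 : M.AugSpace → A → ℝ) 1) := isCompact_Icc
  obtain ⟨f, hf, φ, hφ, hlim⟩ := hK.tendsto_subseq (x := fun n x a => (π n x a).toReal) fun n =>
    ⟨fun x a => ENNReal.toReal_nonneg, fun x a => by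
      rw [Pi.one_apply, Pi.one_apply, ← ENNReal.toReal_one]
      exact ENNReal.toReal_mono ENNReal.one_ne_top (PMF.coe_le_one _ _)⟩
  have hlim' : ∀ x a, Tendsto (fun n => (π (φ n) x a).toReal) atTop (𝓝 (f x a)) := fun x a =>
    tendsto_pi_nhds.1 (tendsto_pi_nhds.1 hlim x) a
  have hsum : ∀ x, ∑ a, f x a = 1 := fun x => by
    refine tendsto_nhds_unique (tendsto_finsetSum Finset.univ fun a _ => hlim' x a) ?_
    simp only [sum_toReal]
    exact tendsto_const_nhds
  refine ⟨fun x => PMF.ofFintype (fun a => ENNReal.ofReal (f x a)) ?_, φ, hφ, fun x a => ?_⟩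
  · rw [← ENNReal.ofReal_sum_of_nonneg fun a _ => hf.1 x a, hsum, ENNReal.ofReal_one]
  · rw [PMF.ofFintype_apply, ENNReal.toReal_ofReal (hf.1 x a)]
    exact hlim' x a

theorem tendsto_JR {ι : Type*} {l : Filter ι} {π : ι → M.Policy} {π₀ : M.Policy}
    (h : ∀ x, 0 < M.occupancy π₀ x → ∀ a,
      Tendsto (fun i => (π i x a).toReal) l (𝓝 (π₀ x a).toReal)) :
    Tendsto (fun i => M.JR (π i)) l (𝓝 (M.JR π₀)) := by
  simp only [JR_eq_value]
  exact M.tendsto_value _ h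

theorem tendsto_JC {σ g : Fin N → ℝ → ℝ} (hg : ∀ i, ConvexOn ℝ Set.univ (g i)) {ι : Type*}
    {l : Filter ι} {π : ι → M.Policy} {π₀ : M.Policy} (h : ∀ x, 0 < M.occupancy π₀ x → ∀ a,
      Tendsto (fun i => (π i x a).toReal) l (𝓝 (π₀ x a).toReal)) (i : Fin N) :
    Tendsto (fun j => M.JC σ g i (π j)) l (𝓝 (M.JC σ g i π₀)) := by
  simp only [M.JC_eq_value σ g i (hg i)]
  exact (M.tendsto_value _ h).add_const _

/-- Optimality depends on a policy only through the states it visits. -/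
theorem IsOptimal.congr {σ g : Fin N → ℝ → ℝ} {d : Fin N → ℝ}
    (hg : ∀ i, ConvexOn ℝ Set.univ (g i)) {π π₀ : M.Policy} (h₀ : M.IsOptimal σ g d π₀)
    (h : ∀ x, 0 < M.occupancy π₀ x → π x = π₀ x) : M.IsOptimal σ g d π := by
  refine ⟨fun i => ?_, fun π' hπ' => ?_⟩
  · rw [M.JC_eq_value σ g i (hg i), M.value_congr _ h, ← M.JC_eq_value σ g i (hg i)]
    exact h₀.1 i
  · rw [M.JR_eq_value π, M.value_congr _ h, ← M.JR_eq_value]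
    exact h₀.2 π' hπ'

theorem gap_of_isFeasible {σ g : Fin N → ℝ → ℝ} {d lam : Fin N → ℝ} {π : M.Policy} {θ : M.Param}
    (h : M.IsFeasible σ g d (M.softmax θ)) :
    M.gap σ g d lam π θ = M.JR π - M.JR (M.softmax θ) := if_pos h

theorem le_gap_of_not_isFeasible {σ g : Fin N → ℝ → ℝ} {d lam : Fin N → ℝ} {π : M.Policy}
    {θ : M.Param} {η : ℝ} (h : ¬ M.IsFeasible σ g d (M.softmax θ)) (hlam : ∀ i, 0 ≤ lam i)
    (h0 : ∀ i, M.JC σ g i (M.softmax θ) ≤ d i → lam i = 0) (h1 : ∑ i, lam i = 1)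
    (hπ : ∀ i, M.JC σ g i π ≤ d i - η) : η ≤ M.gap σ g d lam π θ := by
  rw [gap, if_neg h, ← one_mul η, ← h1, Finset.sum_mul]
  refine Finset.sum_le_sum fun i _ => ?_
  by_cases hi : M.JC σ g i (M.softmax θ) ≤ d i
  · rw [h0 i hi, zero_mul, zero_mul]
  · exact mul_le_mul_of_nonneg_left (by linarith [hπ i, not_le.1 hi]) (hlam i)

/-- The iterates are infinitely often feasible and nearly as good as any given feasible policy. -/
theorem frequently_near_optimal {σ g : Fin N → ℝ → ℝ} {d : Fin N → ℝ} {α : ℕ → ℝ}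
    (hα : RobbinsMonro α) {lam : ℕ → Fin N → ℝ} {θ : ℕ → M.Param} {K : ℝ}
    (hstep : ∀ᶠ t in atTop, ∀ π, M.potential π (θ (t + 1)) ≤
      M.potential π (θ t) - α t * M.gap σ g d (lam t) π (θ t) + K * α t ^ 2)
    (hinf : ∀ t, ¬ M.IsFeasible σ g d (M.softmax (θ t)) → ∀ (π : M.Policy) (η : ℝ),
      (∀ i, M.JC σ g i π ≤ d i - η) → η ≤ M.gap σ g d (lam t) π (θ t))
    {η : ℝ} (hη : 0 < η) {πf : M.Policy} (hπf : ∀ i, M.JC σ g i πf ≤ d i - η)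
    {π : M.Policy} (hπ : M.IsFeasible σ g d π) {ε : ℝ} (hε : 0 < ε) :
    ∃ᶠ t in atTop, M.IsFeasible σ g d (M.softmax (θ t)) ∧
      M.JR π - ε < M.JR (M.softmax (θ t)) := by
  intro hcon
  set Δ := |M.JR π - M.JR πf| with hΔ
  have hΔ0 : 0 ≤ Δ := abs_nonneg _
  set δ := min (1 / 2) (ε / (2 * (Δ + 1))) with hδ
  have hδ0 : 0 < δ := by positivity
  have hδ1 : δ ≤ 1 / 2 := min_le_left _ _
  have hδ2 : δ * Δ ≤ ε / 2 := by
    have h : δ ≤ ε / (2 * (Δ + 1)) := min_le_right _ _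
    rw [le_div_iff₀ (by positivity)] at h
    nlinarith
  refine hα.false_of_eventually_le_sub (Φ := fun t => (1 - δ) * M.potential π (θ t) + δ * M.potential πf (θ t))
    (c := min (ε / 2) (δ * η)) (K := K)
    (fun t => add_nonneg (mul_nonneg (by linarith) (M.potential_nonneg _ _))
      (mul_nonneg hδ0.le (M.potential_nonneg _ _))) (by positivity) ?_
  filter_upwards [hstep, hcon] with t hs hc
  have h1 := mul_le_mul_of_nonneg_left (hs π) (show 0 ≤ 1 - δ by linarith)
  have h2 := mul_le_mul_of_nonneg_left (hs πf) hδ0.le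
  suffices h : min (ε / 2) (δ * η) ≤ (1 - δ) * M.gap σ g d (lam t) π (θ t) +
      δ * M.gap σ g d (lam t) πf (θ t) by
    have := mul_le_mul_of_nonneg_left h (hα.pos t).le
    linarith
  by_cases hf : M.IsFeasible σ g d (M.softmax (θ t))
  · refine (min_le_left _ _).trans ?_
    rw [M.gap_of_isFeasible hf, M.gap_of_isFeasible hf]
    have h3 : M.JR (M.softmax (θ t)) ≤ M.JR π - ε := not_lt.1 fun h => hc ⟨hf, h⟩
    have h4 := mul_le_mul_of_nonneg_left (le_abs_self (M.JR π - M.JR πf)) hδ0.le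
    linarith
  · refine (min_le_right _ _).trans ?_
    have h3 := hinf t hf π 0 (fun i => by simpa using hπ i)
    have h4 := hinf t hf πf η hπf
    have h5 := mul_nonneg (show 0 ≤ 1 - δ by linarith) h3
    have h6 := mul_le_mul_of_nonneg_left h4 hδ0.le
    linarith

/-- Some optimal policy is a limit point of the iterates. -/
theorem exists_isOptimal_subseq {σ g : Fin N → ℝ → ℝ} {d : Fin N → ℝ}
    (hg : ∀ i, ConvexOn ℝ Set.univ (g i)) {π : ℕ → M.Policy} {πf : M.Policy}
    (hπf : M.IsFeasible σ g d πf)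
    (h : ∀ π', M.IsFeasible σ g d π' → ∀ ε > 0, ∃ᶠ t in atTop,
      M.IsFeasible σ g d (π t) ∧ M.JR π' - ε < M.JR (π t)) :
    ∃ πs : M.Policy, M.IsOptimal σ g d πs ∧ ∃ φ : ℕ → ℕ, StrictMono φ ∧
      ∀ x a, Tendsto (fun n => (π (φ n) x a).toReal) atTop (𝓝 (πs x a).toReal) := by
  obtain ⟨B, hB⟩ := M.exists_abs_reward_le M.rewardR
  set V : Set ℝ := M.JR '' {π' | M.IsFeasible σ g d π'} with hV
  have hVb : BddAbove V := by
    refine ⟨B / (1 - M.γ), ?_⟩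
    rintro _ ⟨π', -, rfl⟩
    rw [JR_eq_value]
    exact (le_abs_self _).trans (M.abs_value_le hB π')
  have hVn : V.Nonempty := ⟨_, πf, hπf, rfl⟩
  have h1 : ∀ n : ℕ, ∃ᶠ t in atTop, M.IsFeasible σ g d (π t) ∧
      sSup V - 1 / ((n : ℝ) + 1) < M.JR (π t) := fun n => by
    have hpos : (0 : ℝ) < 1 / ((n : ℝ) + 1) := by positivity
    obtain ⟨_, ⟨π', hπ', rfl⟩, hlt⟩ := exists_lt_of_lt_csSup hVn
      (show sSup V - 1 / ((n : ℝ) + 1) < sSup V by linarith)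
    refine (h π' hπ' (M.JR π' - (sSup V - 1 / ((n : ℝ) + 1))) (by linarith)).mono fun t ht => ?_
    exact ⟨ht.1, by linarith [ht.2]⟩
  obtain ⟨φ, hφ, hP⟩ := extraction_forall_of_frequently h1
  obtain ⟨πs, ψ, hψ, hlim⟩ := M.exists_subseq_tendsto fun n => π (φ n)
  refine ⟨πs, ⟨fun i => ?_, fun π' hπ' => ?_⟩, φ ∘ ψ, hφ.comp hψ, hlim⟩
  · exact le_of_tendsto (M.tendsto_JC hg (fun x _ a => hlim x a) i)
      (Eventually.of_forall fun n => (hP (ψ n)).1 i)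
  · refine (le_csSup hVb ⟨π', hπ', rfl⟩).trans ?_
    have h2 : Tendsto (fun n => sSup V - 1 / ((ψ n : ℝ) + 1)) atTop (𝓝 (sSup V - 0)) :=
      (tendsto_one_div_add_atTop_nhds_zero_nat.comp hψ.tendsto_atTop).const_sub _
    rw [sub_zero] at h2
    exact le_of_tendsto_of_tendsto' h2 (M.tendsto_JR fun x _ a => hlim x a)
      fun n => (hP (ψ n)).2.le

end CMDP
end
end RiskRL

theorem mainTheorem1 {S A : Type*} {N : ℕ} [Fintype A] [Nonempty A]
    (M : RiskRL.CMDP S A N) [Fintype M.AugSpace]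
    (σ g : Fin N → ℝ → ℝ) (d : Fin N → ℝ)
    (hσ : ∀ i, RiskRL.IsSpectrum (σ i))
    (hg : ∀ i, RiskRL.IsDualFunction (σ i) (g i))
    (η : ℝ) (hη : 0 < η)
    (hfeas : ∃ πf : M.Policy, ∀ i, M.JC σ g i πf ≤ d i - η)
    (α : ℕ → ℝ) (hα : RiskRL.RobbinsMonro α)
    (lamMax : ℝ) (lam : ℕ → Fin N → ℝ) (ν : ℕ → ℝ)
    (hlam : ∀ t i, lam t i ∈ Set.Icc 0 lamMax)
    (hν : ∀ t, ν t ∈ Set.Icc 0 lamMax)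
    (θ : ℕ → M.Param)
    (hviol : ∀ t, ¬ M.IsFeasible σ g d (M.softmax (θ t)) →
      (∀ i, M.JC σ g i (M.softmax (θ t)) ≤ d i → lam t i = 0) ∧ ∑ i, lam t i = 1)
    (hupd : ∀ t, θ (t + 1) = M.update σ g d (α t) (lam t) (ν t) (θ t)) :
    (∃ πs : M.Policy, M.IsOptimal σ g d πs ∧
      (∀ x : M.AugSpace, 0 < M.occupancy πs x → ∀ a : A,
        Tendsto (fun t => (M.softmax (θ t) x a).toReal) atTop (𝓝 (πs x a).toReal)) ∧
      Tendsto (fun t => M.JR (M.softmax (θ t))) atTop (𝓝 (M.JR πs)) ∧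
      ∀ i, Tendsto (fun t => M.JC σ g i (M.softmax (θ t))) atTop (𝓝 (M.JC σ g i πs))) ∧
    (∀ ε : ℝ, 0 < ε → ∀ᶠ t in atTop, ∃ π : M.Policy, M.IsOptimal σ g d π ∧
      ∀ (x : M.AugSpace) (a : A), |(M.softmax (θ t) x a).toReal - (π x a).toReal| < ε) := by
  have hgc : ∀ i, ConvexOn ℝ Set.univ (g i) := fun i => (hg i).convex
  obtain ⟨πf, hπf⟩ := hfeas
  have hπf' : M.IsFeasible σ g d πf := fun i => (hπf i).trans (by linarith)
  obtain ⟨δ, hδ, K, hK⟩ := M.exists_potential_update_le (σ := σ) hgc d lamMax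
  have hstep : ∀ᶠ t in atTop, ∀ π, M.potential π (θ (t + 1)) ≤
      M.potential π (θ t) - α t * M.gap σ g d (lam t) π (θ t) + K * α t ^ 2 := by
    filter_upwards [hα.tendsto_zero.eventually_le_const hδ] with t ht π
    rw [hupd t]
    exact hK (α t) (hα.pos t).le ht (lam t) (ν t) (hlam t) (hν t) π (θ t)
  have hinf : ∀ t, ¬ M.IsFeasible σ g d (M.softmax (θ t)) → ∀ (π : M.Policy) (η : ℝ),
      (∀ i, M.JC σ g i π ≤ d i - η) → η ≤ M.gap σ g d (lam t) π (θ t) := fun t ht π η hπ =>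
    M.le_gap_of_not_isFeasible ht (fun i => (hlam t i).1) (hviol t ht).1 (hviol t ht).2 hπ
  obtain ⟨πs, hopt, φ, hφ, hlim⟩ := M.exists_isOptimal_subseq hgc
    (π := fun t => M.softmax (θ t)) hπf' fun π' hπ' ε hε =>
      M.frequently_near_optimal hα hstep hinf hη hπf hπ' hε
  have hgap : ∀ t, 0 ≤ M.gap σ g d (lam t) πs (θ t) := fun t => by
    by_cases hf : M.IsFeasible σ g d (M.softmax (θ t))
    · rw [M.gap_of_isFeasible hf]
      exact sub_nonneg.2 (hopt.2 _ hf)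
    · exact hinf t hf πs 0 (fun i => by simpa using hopt.1 i)
  obtain ⟨l, hl⟩ := hα.exists_tendsto (Φ := fun t => M.potential πs (θ t)) (K := K)
    (fun t => M.potential_nonneg _ _) (hstep.mono fun t ht => by
      have h1 := ht πs
      have h2 := mul_nonneg (hα.pos t).le (hgap t)
      linarith)
  have hl' : l = M.entropy πs := tendsto_nhds_unique (hl.comp hφ.tendsto_atTop)
    (M.tendsto_potential (θ := fun n => θ (φ n)) hlim)
  have hconv := M.tendsto_softmax_of_tendsto_potential (hl' ▸ hl)
  refine ⟨⟨πs, hopt, hconv, M.tendsto_JR hconv, M.tendsto_JC hgc hconv⟩, fun ε hε => ?_⟩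
  classical
  have hev : ∀ᶠ t in atTop, ∀ x a, 0 < M.occupancy πs x →
      |(M.softmax (θ t) x a).toReal - (πs x a).toReal| < ε := by
    refine eventually_all.2 fun x => eventually_all.2 fun a => ?_
    by_cases hx : 0 < M.occupancy πs x
    · exact ((Metric.tendsto_nhds.1 (hconv x hx a)) ε hε).mono fun t ht _ => ht
    · exact Eventually.of_forall fun t h => absurd h hx
  filter_upwards [hev] with t ht
  refine ⟨fun x => if 0 < M.occupancy πs x then πs x else M.softmax (θ t) x,
    RiskRL.CMDP.IsOptimal.congr M hgc hopt fun x hx => if_pos hx, fun x a => ?_⟩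
  by_cases hx : 0 < M.occupancy πs x
  · simpa only [if_pos hx] using ht x a hx
  · simpa only [if_neg hx, sub_self, abs_zero] using hε
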